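/- Words over a finite alphabet $A$ are viewed as labelled linear graphs and $\mathbf{FO}[<]$ is first-order logic with the letter predicates and the order of positions. An *FO graph transduction* $T=(A,B,\varphi_{dom},C,(\varphi_b^c(x)),(\varphi_\le^{c,c'}(x,y)))$ consists of finite alphabets $A,B$, a finite set $C$ of copies and $\mathbf{FO}[<]$-formulas over $A$, where for each $c$ the formulas $\varphi_b^c$, $b\in B$, are mutually exclusive on all words. Over a word $u$ its output structure has as nodes the pairs $(c,i)$ such that $u\models\varphi^c_b(i)$ for some $b$, which is then the label of $(c,i)$, and $(c,i)\le(c',j)$ iff $u\models\varphi_\le^{c,c'}(i,j)$. The image of $u$ is $v\in B^*$ if $u\models\varphi_{dom}$ and the output structure is a (reflexive) linear order whose successive labels spell $v$; otherwise it is undefined. A *two-way transducer with FO look-around* has a finite state set $Q$, an initial state, a set of final states, and finitely many transitions $(q,\varphi(x),q',v,\psi(x,y))$ with $v\in B^*$ and $\varphi,\psi$ $\mathbf{FO}[<]$-formulas over $A\uplus\{\vdash,\dashv\}$. On input $u$, from state $q$ and position $i$ of $\vdash u\dashv$ with $\vdash u\dashv\models\varphi(i)$, such a transition outputs $v$ and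 moves to state $q'$ and a position $j$ with $\vdash u\dashv\models\psi(i,j)$. An accepting run starts at $\vdash$ in the initial state and ends at $\dashv$ in a final state; its output is the image of $u$. The transducer is *deterministic* if on all words the tests $\varphi$ of the transitions from a given state are mutually exclusive and each $\psi$ determines at most one $j$ for each $i$. If each word $u$ has at most one accepting run, let $path(u)\in(Q\times\{0,\dots,|u|+1\})^*$ be its sequence of states and positions (undefined if there is no accepting run), and let $path_{vw}(vuw)$ be obtained from $path(vuw)$ by keeping only the pairs whose position lies in $v$ or in $w$, these positions being renumbered $1,\dots,|v|+|w|$ in increasing order. The transducer is *aperiodic* if there is $n\ge1$ such that for all $u,v,w\in A^*$, $path_{vw}(vu^nw)=path_{vw}(vu^{n+1}w)$ (one side being defined iff the other is). **Theorem.** There is an algorithm which, given an FO graph transduction $T$ with copy set $C$, computes a deterministic two-way transducer $\mathcal A$ with FO look-around, with at most one accepting path on each word, that realizes the same partial function on words as $T$ and is aperiodic. Moreover, its state set is $C\uplus\{i,f\}$, with $i$ initial and $f$ the only final state, and it follows the output structure of $T$: for every $u$ in the domain of $T$, if $(c_1,p_1),\dots,(c_m,p_m)$ are the nodes of the output structure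 of $T$ over $u$ in increasing order (positions numbered from $1$), then the accepting path of $\mathcal A$ over $u$ is $(i,0),(c_1,p_1),\dots,(c_m,p_m),(f,|u|+1)$. -/

import Mathlib

open FirstOrder

namespace FOWords

/-! ### First-order logic over words -/

/-- Relation symbols of `FO[<]` over words: one unary symbol per letter and the order of
positions.  (Equality is part of the logic.) -/
inductive WordRel (A : Type) : ℕ → Type
  | letter (a : A) : WordRel A 1
  | lt : WordRel A 2

/-- The first-order language of words over the alphabet `A`. -/
def wordLang (A : Type) : Language := ⟨fun _ => Empty, WordRel A⟩

/-- The positions of a word, i.e. the vertices of the associated linear graph. -/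
abbrev Pos {A : Type} (w : List A) : Type := Fin w.length

/-- A word as a logical structure: the linear graph of its positions with their labels. -/
instance wordStructure {A : Type} (w : List A) : (wordLang A).Structure (Pos w) where
  funMap f _ := Empty.elim f
  RelMap r x := match r, x with
    | WordRel.letter a, x => List.get w (x 0) = a
    | WordRel.lt, x => Fin.val (x 0) < Fin.val (x 1)

/-- `w ⊨ φ(i)`. -/
def Sat₁ {A : Type} (w : List A) (φ : (wordLang A).Formula (Fin 1)) (i : Pos w) : Prop :=
  φ.Realize ![i]

/-- `w ⊨ ψ(i, j)`, where the first free variable is `x` and the second one is `y`. -/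
def Sat₂ {A : Type} (w : List A) (ψ : (wordLang A).Formula (Fin 2)) (i j : Pos w) : Prop :=
  ψ.Realize ![i, j]

/-! ### First-order graph transductions -/

/-- An `FO` graph transduction with input alphabet `A`, output alphabet `B` and set of copies
`C`, whose inputs are words. -/
structure Transduction (A B C : Type) where
  /-- the domain formula -/
  dom : (wordLang A).Sentence
  /-- the position formulas `φ_b^c(x)` -/
  pos : C → B → (wordLang A).Formula (Fin 1)
  /-- the order formulas `φ_≤^{c,c'}(x, y)` -/
  ord : C → C → (wordLang A).Formula (Fin 2)
  /-- for each copy `c`, the formulas `φ_b^c` are mutually exclusive -/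
  pos_exclusive : ∀ (u : List A) (c : C) (i : Pos u) (b b' : B),
    Sat₁ u (pos c b) i → Sat₁ u (pos c b') i → b = b'

namespace Transduction

variable {A B C : Type} (T : Transduction A B C)

/-- The `c` copy of position `i` is labelled by `b` in the output graph over `u`. -/
def Label (u : List A) (x : C × Pos u) (b : B) : Prop := Sat₁ u (T.pos x.1 b) x.2

/-- The `c` copy of position `i` exists in the output graph over `u`. -/
def IsNode (u : List A) (x : C × Pos u) : Prop := ∃ b, T.Label u x b

/-- The order relation of the output graph over `u`: there is a (possibly empty) path
from `x` to `y`. -/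
def Le (u : List A) (x y : C × Pos u) : Prop := Sat₂ u (T.ord x.1 y.1) x.2 y.2

/-- The input `u` satisfies the domain formula, and the output graph over `u` is a linear graph
whose successive vertices are `ns`. -/
def IsLinearOutput (u : List A) (ns : List (C × Pos u)) : Prop :=
  Language.Sentence.Realize (Pos u) T.dom ∧
  (∀ x, x ∈ ns ↔ T.IsNode u x) ∧
  ∀ s t : Fin ns.length, T.Le u (ns.get s) (ns.get t) ↔ s ≤ t

/-- `v` is the image of `u`: the output graph over `u` is the linear graph of the word `v`. -/
def Maps (u : List A) (v : List B) : Prop :=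
  ∃ ns, T.IsLinearOutput u ns ∧ List.Forall₂ (T.Label u) ns v

end Transduction

/-! ### Two-way transducers with first-order look-around -/

/-- The input alphabet enriched with the two endmarkers. -/
inductive Marked (A : Type) : Type
  | left : Marked A
  | letter (a : A) : Marked A
  | right : Marked A

/-- The marked word `⊢ u ⊣`. -/
def mark {A : Type} (u : List A) : List (Marked A) :=
  Marked.left :: (u.map Marked.letter ++ [Marked.right])

/-- A transition `(q, φ(x), q', v, ψ(x, y))`. -/
structure Transition (A B Q : Type) where
  src : Q
  test : (wordLang (Marked A)).Formula (Fin 1)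
  dst : Q
  out : List B
  move : (wordLang (Marked A)).Formula (Fin 2)

/-- A two-way transducer with `FO` look-around; only membership in the list `trans` matters. -/
structure Transducer (A B Q : Type) where
  trans : List (Transition A B Q)
  init : Q
  final : Finset Q

namespace Transducer

variable {A B Q : Type} (M : Transducer A B Q)

/-- The unary tests of a given state are mutually exclusive, and every movement formula defines
at most one target from any position. -/
def Deterministic : Prop :=
  (∀ (u : List A) (i : Pos (mark u)), ∀ t ∈ M.trans, ∀ t' ∈ M.trans, t.src = t'.src →
    Sat₁ (mark u) t.test i → Sat₁ (mark u) t'.test i → t = t') ∧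
  (∀ (u : List A) (i j j' : Pos (mark u)), ∀ t ∈ M.trans,
    Sat₂ (mark u) t.move i j → Sat₂ (mark u) t.move i j' → j = j')

/-- One step over `⊢ u ⊣` between two configurations, with its production. -/
def Step (u : List A) (x : Q × Pos (mark u)) (v : List B) (y : Q × Pos (mark u)) : Prop :=
  ∃ t ∈ M.trans, t.src = x.1 ∧ Sat₁ (mark u) t.test x.2 ∧ t.dst = y.1 ∧ t.out = v ∧
    Sat₂ (mark u) t.move x.2 y.2

/-- `M.IsRun u r v`: the list `r` of configurations is a run over `⊢ u ⊣` with production `v`. -/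
inductive IsRun (u : List A) : List (Q × Pos (mark u)) → List B → Prop
  | single (x : Q × Pos (mark u)) : IsRun u [x] []
  | cons {x y : Q × Pos (mark u)} {r : List (Q × Pos (mark u))} {v v' : List B} :
      M.Step u x v y → IsRun u (y :: r) v' → IsRun u (x :: y :: r) (v ++ v')

/-- An accepting run over `⊢ u ⊣` starts at the first position in the initial state and ends on
the right endmarker in a final state. -/
def IsAcceptingRun (u : List A) (r : List (Q × Pos (mark u))) (v : List B) : Prop :=
  M.IsRun u r v ∧
  (∃ x, r.head? = some x ∧ x.1 = M.init ∧ Fin.val x.2 = 0) ∧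
  (∃ y, r.getLast? = some y ∧ y.1 ∈ M.final ∧ Fin.val y.2 = u.length + 1)

/-- `v` is the image of `u` by `M`. -/
def Maps (u : List A) (v : List B) : Prop := ∃ r, M.IsAcceptingRun u r v

/-- `p` is the accepting path of `M` over `u`, a sequence of pairs in `Q × {0, …, |u| + 1}`. -/
def IsAcceptingPath (u : List A) (p : List (Q × ℕ)) : Prop :=
  ∃ r v, M.IsAcceptingRun u r v ∧ p = r.map fun x => (x.1, Fin.val x.2)

end Transducer

/-- The projection of a path to an ordered sequence `I = [i₁, …, i_k]` of positions: the pairs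
whose position is in `I` are kept, and `i_j` is renamed to `j`. -/
def project {Q : Type} (I : List ℕ) (p : List (Q × ℕ)) : List (Q × ℕ) :=
  p.filterMap fun x => if x.2 ∈ I then some (x.1, I.idxOf x.2 + 1) else none

/-- The positions of `v` and `w` in the word `vuw`, the first letter being at position `1`. -/
def contextPositions {A : Type} (v u w : List A) : List ℕ :=
  List.range' 1 v.length ++ List.range' (v.length + u.length + 1) w.length

/-- `u ^ n`. -/
def wordPow {A : Type} (u : List A) (n : ℕ) : List A := (List.replicate n u).flatten

namespace Transducer

variable {A B Q : Type} (M : Transducer A B Q)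

/-- `c` is the context path `path_{vw}(vuw)`, which exists when `vuw` is accepted. -/
def IsContextPath (v u w : List A) (c : List (Q × ℕ)) : Prop :=
  ∃ p, M.IsAcceptingPath (v ++ u ++ w) p ∧ c = project (contextPositions v u w) p

/-- Aperiodicity by path contexts: for some `n > 0`, the context paths `path_{vw}(vu^nw)` and
`path_{vw}(vu^{n+1}w)` are equal for all `u`, `v`, `w` (in particular one exists if and only if
the other one does). -/
def Aperiodic : Prop :=
  ∃ n : ℕ, 0 < n ∧ ∀ (u v w : List A) (c : List (Q × ℕ)),
    M.IsContextPath v (wordPow u n) w c ↔ M.IsContextPath v (wordPow u (n + 1)) w c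

end Transducer

/-! ### Finite descriptions

Formulas, transductions and transducers are finite objects; they are written down as nested lists
of natural numbers, on which computability has its usual meaning. -/

/-- A formula is written in Polish notation, as a sequence of symbols; a symbol is a tag with up
to two arguments. -/
abbrev FormulaCode : Type := List (ℕ × ℕ × ℕ)

/-- Variables: the free variable `i` is numbered `2i`, the variable bound by the `j`-th enclosing
quantifier is numbered `2j + 1`. -/
def termCode {A α : Type} (f : α → ℕ) {n : ℕ} : (wordLang A).Term (α ⊕ Fin n) → ℕ
  | .var (.inl i) => 2 * f i
  | .var (.inr j) => 2 * j.val + 1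
  | .func g _ => Empty.elim g

/-- The Polish notation of a formula, given numberings `l` of the letters and `f` of the free
variables. -/
def formulaCode {A α : Type} (l : A → ℕ) (f : α → ℕ) :
    {n : ℕ} → (wordLang A).BoundedFormula α n → FormulaCode
  | _, .falsum => [(0, 0, 0)]
  | _, .equal s t => [(1, termCode f s, termCode f t)]
  | _, .rel R ts => match R, ts with
    | WordRel.letter a, ts => [(2, l a, termCode f (ts 0))]
    | WordRel.lt, ts => [(3, termCode f (ts 0), termCode f (ts 1))]
  | _, .imp φ ψ => (4, 0, 0) :: (formulaCode l f φ ++ formulaCode l f ψ)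
  | n, .all φ => (5, 2 * n + 1, 0) :: formulaCode l f φ

/-- Numbering of the marked alphabet. -/
def markedCode {a : ℕ} : Marked (Fin a) → ℕ
  | .left => 0
  | .right => 1
  | .letter x => x.val + 2

/-- Sizes of the alphabets and of the copy set; domain formula; position formulas; order
formulas. -/
abbrev TransductionCode : Type :=
  (ℕ × ℕ × ℕ) × FormulaCode × List (List FormulaCode) × List (List FormulaCode)

/-- The finite description of a transduction. -/
def Transduction.code {a b k : ℕ} (T : Transduction (Fin a) (Fin b) (Fin k)) :
    TransductionCode :=
  ((a, b, k),
    formulaCode Fin.val Empty.elim T.dom,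
    List.ofFn fun c => List.ofFn fun x => formulaCode Fin.val Fin.val (T.pos c x),
    List.ofFn fun c => List.ofFn fun c' => formulaCode Fin.val Fin.val (T.ord c c'))

/-- Source, test, target, production, movement. -/
abbrev TransitionCode : Type := ℕ × FormulaCode × ℕ × List ℕ × FormulaCode

/-- The finite description of a transition. -/
def Transition.code {a b q : ℕ} (t : Transition (Fin a) (Fin b) (Fin q)) : TransitionCode :=
  (t.src.val, formulaCode markedCode Fin.val t.test, t.dst.val, t.out.map Fin.val,
    formulaCode markedCode Fin.val t.move)

/-- Sizes of the alphabets and of the state set; transitions; initial state; characteristic vector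
of the set of final states. -/
abbrev TransducerCode : Type := (ℕ × ℕ × ℕ) × List TransitionCode × ℕ × List Bool

/-- The finite description of a transducer. -/
def Transducer.code {a b q : ℕ} (M : Transducer (Fin a) (Fin b) (Fin q)) : TransducerCode :=
  ((a, b, q), M.trans.map Transition.code, M.init.val, List.ofFn fun s => decide (s ∈ M.final))

end FOWords

/-!
A transduction whose output over `u` is a linear order is followed by a head that moves from each
vertex of the output graph to its successor. Being linearly ordered and being the successor are
first-order properties, so the tests and the movements of such a transducer are `FO` formulas.

To treat the first and the last moves like the others, the output graph is completed by a least
vertex at `⊢`, in a new copy that serves as initial state, and by a greatest vertex at `⊣`, in a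
new copy that serves as final state (`Transduction.markedSpec`). The formulas of the transduction
are relativized to the positions that carry a letter (`realize_relativize`). All tests and all
movements contain a sentence that says that the completed graph is linearly ordered
(`GraphSpec.realize_linearFormula`). Successors are then unique, whence determinism, and a run that
starts at `⊢` and reaches the final state enumerates all vertices in increasing order
(`Transduction.isAcceptingRun_iff`).

Aperiodicity expresses that first-order logic cannot count: for every formula there is a bound above
which inserting one more `u` in a power of `u` does not change the truth of the formula at the
positions outside this power (`eventually_realize_iff`). This is an Ehrenfeucht-Fraïssé game, whose
invariant is that the two words are `p ++ wordPow u L ++ q` and `p ++ wordPow u (L + 1) ++ q` with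
`L` large, all chosen positions being outside the power. A move inside the power falls in one of its
factors, and the longer of the two powers on its sides is at least about `L / 2` long, so that the
invariant can be restored. A context path is the increasing enumeration of the vertices at the
positions outside the power; it is determined by the vertices and by the order there, hence does not
change either (`Transduction.aperiodic_toTransducer`).

For effectiveness, the Polish notation turns relativization and substitution of variables into
symbol-by-symbol operations, because the bound variables are numbered by their level
(`formulaCode_relativize`, `formulaCode_relabel`). The whole construction on descriptions is then
primitive recursive (`primrec_transducerCode`).
-/

namespace FOWords

/-! ### Enumerations of finite linear orders -/

section Enumerates

variable {X : Type*} {P : X → Prop} {R : X → X → Prop}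

/-- `l` lists the elements satisfying `P`, in increasing order for the reflexive order `R`. -/
def Enumerates (P : X → Prop) (R : X → X → Prop) (l : List X) : Prop :=
  (∀ x, x ∈ l ↔ P x) ∧ ∀ s t : Fin l.length, R (l.get s) (l.get t) ↔ s ≤ t

/-- `R` restricts to a linear order on the elements satisfying `P`; reflexivity is the case
`x = y` of totality. -/
structure IsLinearOn (P : X → Prop) (R : X → X → Prop) : Prop where
  total : ∀ x y, P x → P y → R x y ∨ R y x
  trans : ∀ x y z, P x → P y → P z → R x y → R y z → R x z
  antisymm : ∀ x y, P x → P y → R x y → R y x → x = y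

/-- `y` is the successor of `x` in the linear order `R` on the elements satisfying `P`. That `y` is
above `x` is written `¬ R y x`, which is equivalent for a linear order. -/
def IsNext (P : X → Prop) (R : X → X → Prop) (x y : X) : Prop :=
  P y ∧ ¬ R y x ∧ ∀ z, P z → R z x ∨ R y z

theorem get_rel_iff_le_iff_pairwise (l : List X) :
    (∀ s t : Fin l.length, R (l.get s) (l.get t) ↔ s ≤ t) ↔
      (∀ x ∈ l, R x x) ∧ l.Pairwise fun x y => R x y ∧ ¬ R y x := by
  constructor
  · intro h
    refine ⟨fun x hx => ?_, ?_⟩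
    · obtain ⟨i, rfl⟩ := List.get_of_mem hx
      exact (h i i).2 le_rfl
    · rw [List.pairwise_iff_get]
      intro i j hij
      exact ⟨(h i j).2 hij.le, fun hc => absurd ((h j i).1 hc) (not_le.2 hij)⟩
  · rintro ⟨h1, h2⟩ s t
    rw [List.pairwise_iff_get] at h2
    rcases lt_trichotomy s t with h | h | h
    · exact ⟨fun _ => h.le, fun _ => (h2 _ _ h).1⟩
    · subst h
      exact ⟨fun _ => le_rfl, fun _ => h1 _ (List.get_mem _ _)⟩
    · exact ⟨fun hc => absurd hc (h2 _ _ h).2, fun hc => absurd hc (not_le.2 h)⟩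

theorem Enumerates.pairwise {l : List X} (h : Enumerates P R l) :
    l.Pairwise fun x y => R x y ∧ ¬ R y x :=
  ((get_rel_iff_le_iff_pairwise l).1 h.2).2

theorem enumerates_iff_pairwise {l : List X} :
    Enumerates P R l ↔
      (∀ x, x ∈ l ↔ P x) ∧ (∀ x ∈ l, R x x) ∧ l.Pairwise fun x y => R x y ∧ ¬ R y x :=
  and_congr Iff.rfl (get_rel_iff_le_iff_pairwise l)

theorem Enumerates.isLinearOn {l : List X} (h : Enumerates P R l) : IsLinearOn P R where
  total x y hx hy := by
    obtain ⟨i, rfl⟩ := List.get_of_mem ((h.1 x).2 hx)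
    obtain ⟨j, rfl⟩ := List.get_of_mem ((h.1 y).2 hy)
    rw [h.2, h.2]
    exact le_total i j
  trans x y z hx hy hz := by
    obtain ⟨i, rfl⟩ := List.get_of_mem ((h.1 x).2 hx)
    obtain ⟨j, rfl⟩ := List.get_of_mem ((h.1 y).2 hy)
    obtain ⟨k, rfl⟩ := List.get_of_mem ((h.1 z).2 hz)
    rw [h.2, h.2, h.2]
    exact le_trans
  antisymm x y hx hy := by
    obtain ⟨i, rfl⟩ := List.get_of_mem ((h.1 x).2 hx)
    obtain ⟨j, rfl⟩ := List.get_of_mem ((h.1 y).2 hy)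
    rw [h.2, h.2]
    exact fun h1 h2 => congrArg _ (le_antisymm h1 h2)

theorem Enumerates.nodup {l : List X} (h : Enumerates P R l) : l.Nodup :=
  h.pairwise.imp fun {x y} hxy hc => by subst hc; exact hxy.2 hxy.1

theorem Enumerates.unique {l l' : List X} (h : Enumerates P R l) (h' : Enumerates P R l') :
    l = l' :=
  ((List.perm_ext_iff_of_nodup h.nodup h'.nodup).2
    fun x => (h.1 x).trans (h'.1 x).symm).eq_of_pairwise
      (fun _ _ _ _ h1 h2 => absurd h1.1 h2.2) h.pairwise h'.pairwise

theorem IsLinearOn.exists_enumerates [Finite X] (h : IsLinearOn P R) :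
    ∃ l, Enumerates P R l := by
  classical
  have := Fintype.ofFinite X
  let r : {x // P x} → {x // P x} → Prop := fun x y => R x y
  have : Std.Total r := ⟨fun x y => h.total x y x.2 y.2⟩
  have : IsTrans _ r := ⟨fun x y z => h.trans x y z x.2 y.2 z.2⟩
  let l := (Finset.univ : Finset {x // P x}).toList.insertionSort r
  have hl : l.Nodup :=
    (List.perm_insertionSort r _).nodup_iff.2 (Finset.nodup_toList _)
  have hs : l.Pairwise r := List.pairwise_insertionSort r _
  refine ⟨l.map Subtype.val, enumerates_iff_pairwise.2 ⟨fun x => ?_, fun x hx => ?_, ?_⟩⟩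
  · simp [l]
  · obtain ⟨y, -, rfl⟩ := List.mem_map.1 hx
    exact (h.total y y y.2 y.2).elim id id
  · rw [List.pairwise_map]
    refine (hs.and hl).imp ?_
    rintro x y ⟨h1, h2⟩
    exact ⟨h1, fun hc => h2 (Subtype.ext (h.antisymm x y x.2 y.2 h1 hc))⟩

theorem Enumerates.isChain_isNext {l : List X} (h : Enumerates P R l) :
    l.IsChain (IsNext P R) := by
  rw [List.isChain_iff_getElem]
  intro i hi
  refine ⟨(h.1 _).1 (List.getElem_mem _), fun hc => ?_, fun z hz => ?_⟩
  · have := (h.2 ⟨i + 1, hi⟩ ⟨i, by omega⟩).1 hc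
    simp at this
  · obtain ⟨j, rfl⟩ := List.get_of_mem ((h.1 z).2 hz)
    rcases Nat.lt_or_ge i j with hij | hij
    · exact Or.inr ((h.2 ⟨i + 1, hi⟩ j).2 hij)
    · exact Or.inl ((h.2 j ⟨i, by omega⟩).2 hij)

theorem IsLinearOn.isNext_unique (h : IsLinearOn P R) {x y y' : X}
    (hy : IsNext P R x y) (hy' : IsNext P R x y') : y = y' :=
  h.antisymm y y' hy.1 hy'.1 ((hy.2.2 y' hy'.1).resolve_left hy'.2.1)
    ((hy'.2.2 y hy.1).resolve_left hy.2.1)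

end Enumerates

/-! ### First-order logic cannot count powers of a factor -/

section Pumping

variable {A : Type}

theorem wordPow_add (u : List A) (m n : ℕ) : wordPow u (m + n) = wordPow u m ++ wordPow u n := by
  rw [wordPow, List.replicate_add, List.flatten_append, wordPow, wordPow]

theorem append_wordPow_left {p u q : List A} {L m n : ℕ} (h : L = m + n) :
    p ++ wordPow u L ++ q = p ++ wordPow u m ++ (wordPow u n ++ q) := by
  simp only [h, wordPow_add, List.append_assoc]

theorem append_wordPow_right {p u q : List A} {L m n : ℕ} (h : L = m + n) :
    p ++ wordPow u L ++ q = p ++ wordPow u m ++ wordPow u n ++ q := by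
  simp only [h, wordPow_add, List.append_assoc]

@[simp]
theorem length_wordPow (u : List A) (n : ℕ) : (wordPow u n).length = n * u.length := by
  simp [wordPow]

/-- The position `x` of `w = p ++ wordPow u L ++ q` lies in `p` or in `q`, and `y` is the
corresponding position of `w' = p ++ wordPow u (L + 1) ++ q`. -/
def Corr (p u : List A) (L : ℕ) {w w' : List A} (x : Pos w) (y : Pos w') : Prop :=
  (x.val < p.length ∧ y.val = x.val) ∨
    (p.length + L * u.length ≤ x.val ∧ y.val = x.val + u.length)

variable {p u q w w' : List A} {L : ℕ}

theorem Corr.get_eq (hw : w = p ++ wordPow u L ++ q) (hw' : w' = p ++ wordPow u (L + 1) ++ q)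
    {x : Pos w} {y : Pos w'} (h : Corr p u L x y) : w.get x = w'.get y := by
  obtain ⟨x, hx⟩ := x
  obtain ⟨y, hy⟩ := y
  subst hw hw'
  simp only [Corr] at h
  simp only [List.get_eq_getElem]
  rcases h with ⟨h1, rfl⟩ | ⟨h1, rfl⟩
  · simp only [List.append_assoc]
    rw [List.getElem_append_left h1, List.getElem_append_left h1]
  · rw [List.getElem_append_right (by simpa using h1),
      List.getElem_append_right (by simp only [List.length_append, length_wordPow]; grind)]
    congr 1
    simp only [List.length_append, length_wordPow]
    grind

theorem Corr.eq_iff {x x₂ : Pos w} {y y₂ : Pos w'} (h : Corr p u L x y)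
    (h₂ : Corr p u L x₂ y₂) : x = x₂ ↔ y = y₂ := by
  simp only [Corr] at h h₂
  rw [Fin.ext_iff, Fin.ext_iff]
  grind

theorem Corr.lt_iff {x x₂ : Pos w} {y y₂ : Pos w'} (h : Corr p u L x y)
    (h₂ : Corr p u L x₂ y₂) : x.val < x₂.val ↔ y.val < y₂.val := by
  simp only [Corr] at h h₂
  grind

/-- The correspondence survives when only the first `L₁` factors count as the pumped power. -/
theorem Corr.left {L₁ : ℕ} (hL : L₁ ≤ L) {x : Pos w} {y : Pos w'} (h : Corr p u L x y) :
    Corr p u L₁ x y := by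
  have : L₁ * u.length ≤ L * u.length := Nat.mul_le_mul_right _ hL
  simp only [Corr] at h ⊢
  omega

/-- The correspondence survives when only the last `L₂` factors count as the pumped power. -/
theorem Corr.right {L₁ L₂ : ℕ} (hL : L = L₁ + L₂) {x : Pos w} {y : Pos w'}
    (h : Corr p u L x y) : Corr (p ++ wordPow u L₁) u L₂ x y := by
  subst hL
  simp only [Corr, List.length_append, length_wordPow, Nat.add_mul] at h ⊢
  omega

theorem exists_block {d n x : ℕ} (h : x < n * d) :
    ∃ j < n, j * d ≤ x ∧ x < (j + 1) * d := by
  have hd : 0 < d := Nat.pos_of_ne_zero (by rintro rfl; simp at h)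
  refine ⟨x / d, (Nat.div_lt_iff_lt_mul hd).2 h, Nat.div_mul_le_self x d, ?_⟩
  exact (Nat.div_lt_iff_lt_mul hd).1 (Nat.lt_succ_self _)

/-- A move of the game at a position `x` of the word with the smaller power. One of the two sides
of the factor containing `x` is still long enough to serve as the pumped power afterwards. -/
theorem exists_corr_forth (hw : w = p ++ wordPow u L ++ q)
    (hw' : w' = p ++ wordPow u (L + 1) ++ q) {K : ℕ} (hK : 2 * K + 1 ≤ L) (x : Pos w) :
    ∃ (y : Pos w') (p' q' : List A) (L' : ℕ), K ≤ L' ∧ w = p' ++ wordPow u L' ++ q' ∧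
      w' = p' ++ wordPow u (L' + 1) ++ q' ∧ Corr p' u L' x y ∧
      ∀ (x₀ : Pos w) (y₀ : Pos w'), Corr p u L x₀ y₀ → Corr p' u L' x₀ y₀ := by
  have hlw : w.length = p.length + L * u.length + q.length := by simp [hw, add_assoc]
  have hlw' : w'.length = p.length + L * u.length + u.length + q.length := by
    simp [hw']; ring
  obtain ⟨x, hx⟩ := x
  rcases Nat.lt_or_ge x p.length with h1 | h1
  · exact ⟨⟨x, by omega⟩, p, q, L, by omega, hw, hw', Or.inl ⟨h1, rfl⟩, fun _ _ => id⟩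
  rcases Nat.lt_or_ge x (p.length + L * u.length) with h2 | h2
  · obtain ⟨j, hj, hj1, hj2⟩ := exists_block (d := u.length) (n := L) (x := x - p.length) (by omega)
    rcases Nat.lt_or_ge j K with h3 | h3
    · have hL : L = (j + 1) + (L - 1 - j) := by omega
      refine ⟨⟨x, by omega⟩, p ++ wordPow u (j + 1), q, L - 1 - j, by omega, ?_, ?_,
        Or.inl ⟨?_, rfl⟩, fun _ _ h => h.right hL⟩
      · exact hw.trans (append_wordPow_right hL)
      · exact hw'.trans (append_wordPow_right (by omega))
      · simp only [List.length_append, length_wordPow]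
        omega
    · have hL : L = j + (L - j) := by omega
      -- the factors before that of `x` become the pumped power, and `x` lies after it
      refine ⟨⟨x + u.length, by omega⟩, p, wordPow u (L - j) ++ q, j, h3, ?_, ?_,
        Or.inr ⟨?_, rfl⟩, fun _ _ h => h.left hj.le⟩
      · exact hw.trans (append_wordPow_left hL)
      · exact hw'.trans (append_wordPow_left (by omega))
      · simp only
        omega
  · exact ⟨⟨x + u.length, by omega⟩, p, q, L, by omega, hw, hw', Or.inr ⟨h2, rfl⟩, fun _ _ => id⟩

/-- A move of the game at a position `y` of the word with the larger power. -/
theorem exists_corr_back (hw : w = p ++ wordPow u L ++ q)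
    (hw' : w' = p ++ wordPow u (L + 1) ++ q) {K : ℕ} (hK : 2 * K + 1 ≤ L) (y : Pos w') :
    ∃ (x : Pos w) (p' q' : List A) (L' : ℕ), K ≤ L' ∧ w = p' ++ wordPow u L' ++ q' ∧
      w' = p' ++ wordPow u (L' + 1) ++ q' ∧ Corr p' u L' x y ∧
      ∀ (x₀ : Pos w) (y₀ : Pos w'), Corr p u L x₀ y₀ → Corr p' u L' x₀ y₀ := by
  have hlw : w.length = p.length + L * u.length + q.length := by simp [hw, add_assoc]
  have hlw' : w'.length = p.length + (L + 1) * u.length + q.length := by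
    simp [hw', add_assoc]
  have hL1 : (L + 1) * u.length = L * u.length + u.length := by ring
  obtain ⟨y, hy⟩ := y
  rcases Nat.lt_or_ge y p.length with h1 | h1
  · exact ⟨⟨y, by omega⟩, p, q, L, by omega, hw, hw', Or.inl ⟨h1, rfl⟩, fun _ _ => id⟩
  rcases Nat.lt_or_ge y (p.length + (L + 1) * u.length) with h2 | h2
  · obtain ⟨j, hj, hj1, hj2⟩ :=
      exists_block (d := u.length) (n := L + 1) (x := y - p.length) (by omega)
    rcases Nat.lt_or_ge K j with h3 | h3
    · obtain ⟨i, rfl⟩ : ∃ i, j = i + 1 := ⟨j - 1, by omega⟩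
      have hL : L = i + (L - i) := by omega
      have hi : (i + 1) * u.length = i * u.length + u.length := by ring
      -- the factors before that of `y` become the pumped power, and `y` lies after it
      refine ⟨⟨y - u.length, by omega⟩, p, wordPow u (L - i) ++ q, i, by omega, ?_, ?_,
        Or.inr ⟨?_, ?_⟩, fun _ _ h => h.left (by omega)⟩
      · exact hw.trans (append_wordPow_left hL)
      · exact hw'.trans (append_wordPow_left (by omega))
      · simp only
        omega
      · simp only
        omega
    · have hL : L = (j + 1) + (L - 1 - j) := by omega
      have hle : (j + 1) * u.length ≤ L * u.length := Nat.mul_le_mul_right _ (by omega)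
      refine ⟨⟨y, by omega⟩, p ++ wordPow u (j + 1), q, L - 1 - j, by omega, ?_, ?_,
        Or.inl ⟨?_, rfl⟩, fun _ _ h => h.right hL⟩
      · exact hw.trans (append_wordPow_right hL)
      · exact hw'.trans (append_wordPow_right (by omega))
      · simp only [List.length_append, length_wordPow]
        omega
  · refine ⟨⟨y - u.length, by omega⟩, p, q, L, by omega, hw, hw', Or.inr ⟨?_, ?_⟩, fun _ _ => id⟩
    · simp only
      omega
    · simp only
      omega

open Filter in
/-- A first-order formula does not distinguish `p ++ wordPow u L ++ q` from
`p ++ wordPow u (L + 1) ++ q` once `L` is large, the bound depending on the formula only.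
The induction on the formula plays an Ehrenfeucht-Fraïssé game in which the pumped power shrinks
by a factor of two at each round. -/
theorem eventually_realize_iff {α : Type} {n : ℕ} (φ : (wordLang A).BoundedFormula α n) :
    ∀ᶠ L in atTop, ∀ (p u q w w' : List A), w = p ++ wordPow u L ++ q →
      w' = p ++ wordPow u (L + 1) ++ q →
      ∀ (f : α → Pos w) (f' : α → Pos w') (g : Fin n → Pos w) (g' : Fin n → Pos w'),
        (∀ a, Corr p u L (f a) (f' a)) → (∀ i, Corr p u L (g i) (g' i)) →
          (φ.Realize f g ↔ φ.Realize f' g') := by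
  induction φ with
  | falsum => exact Eventually.of_forall fun _ _ _ _ _ _ _ _ _ _ _ _ _ _ => Iff.rfl
  | equal s t =>
    refine Eventually.of_forall fun L p u q w w' hw hw' f f' g g' hf hg => ?_
    have hs : ∀ t : (wordLang A).Term (α ⊕ Fin _),
        Corr p u L (t.realize (Sum.elim f g)) (t.realize (Sum.elim f' g')) := by
      rintro ((a | i) | ⟨c, _⟩)
      · exact hf a
      · exact hg i
      · exact c.elim
    exact (hs s).eq_iff (hs t)
  | rel R ts =>
    refine Eventually.of_forall fun L p u q w w' hw hw' f f' g g' hf hg => ?_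
    have hs : ∀ t : (wordLang A).Term (α ⊕ Fin _),
        Corr p u L (t.realize (Sum.elim f g)) (t.realize (Sum.elim f' g')) := by
      rintro ((a | i) | ⟨c, _⟩)
      · exact hf a
      · exact hg i
      · exact c.elim
    cases R with
    | letter a => exact Eq.congr_left ((hs (ts 0)).get_eq hw hw')
    | lt => exact (hs (ts 0)).lt_iff (hs (ts 1))
  | imp φ ψ ihφ ihψ =>
    filter_upwards [ihφ, ihψ] with L h1 h2 p u q w w' hw hw' f f' g g' hf hg
    exact imp_congr (h1 p u q w w' hw hw' f f' g g' hf hg) (h2 p u q w w' hw hw' f f' g g' hf hg)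
  | all φ ih =>
    obtain ⟨K, hK⟩ := eventually_atTop.1 ih
    filter_upwards [eventually_ge_atTop (2 * K + 1)] with L hL p u q w w' hw hw' f f' g g' hf hg
    rw [Language.BoundedFormula.realize_all, Language.BoundedFormula.realize_all]
    constructor
    · intro h y
      obtain ⟨x, p', q', L', hL', hp, hp', hc, hm⟩ := exists_corr_back hw hw' hL y
      refine (hK L' hL' p' u q' w w' hp hp' f f' _ _ (fun a => hm _ _ (hf a)) ?_).1 (h x)
      intro i
      refine Fin.lastCases ?_ (fun i => ?_) i
      · simpa using hc
      · simpa using hm _ _ (hg i)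
    · intro h x
      obtain ⟨y, p', q', L', hL', hp, hp', hc, hm⟩ := exists_corr_forth hw hw' hL x
      refine (hK L' hL' p' u q' w w' hp hp' f f' _ _ (fun a => hm _ _ (hf a)) ?_).2 (h y)
      intro i
      refine Fin.lastCases ?_ (fun i => ?_) i
      · simpa using hc
      · simpa using hm _ _ (hg i)

end Pumping

/-! ### Formulas defining successors in a first-order definable order -/

section Connectives

variable {L : Language} {α M : Type} [L.Structure M] {n : ℕ}

/-- Finite conjunction, written `¬ (φ₁ → ⋯ → φₖ → ⊥)`. -/
def conj (l : List (L.BoundedFormula α n)) : L.BoundedFormula α n :=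
  (l.foldr Language.BoundedFormula.imp ⊥).not

/-- Finite disjunction, written `¬ φ₁ → ⋯ → ¬ φₖ → ⊥`. -/
def disj (l : List (L.BoundedFormula α n)) : L.BoundedFormula α n :=
  l.foldr (fun φ ψ => φ.not.imp ψ) ⊥

@[simp]
theorem realize_conj {l : List (L.BoundedFormula α n)} {v : α → M} {xs : Fin n → M} :
    (conj l).Realize v xs ↔ ∀ φ ∈ l, φ.Realize v xs := by
  rw [conj, Language.BoundedFormula.realize_not]
  induction l with
  | nil => simp
  | cons φ l ih => simp [ih]

@[simp]
theorem realize_disj {l : List (L.BoundedFormula α n)} {v : α → M} {xs : Fin n → M} :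
    (disj l).Realize v xs ↔ ∃ φ ∈ l, φ.Realize v xs := by
  induction l with
  | nil => simp [disj]
  | cons φ l ih =>
    rw [disj] at ih ⊢
    rw [List.foldr_cons, Language.BoundedFormula.realize_imp, ih,
      Language.BoundedFormula.realize_not, List.exists_mem_cons_iff, or_iff_not_imp_left]

/-- The formula `φ` with free variable `a` replaced by the variable `g a`, placed under `n`
quantifiers. -/
def substVar {β : Type} (g : α → β ⊕ Fin n) (φ : L.Formula α) : L.BoundedFormula β n :=
  Language.BoundedFormula.relabel g φ

theorem realize_substVar {β : Type} {φ : L.Formula α} {g : α → β ⊕ Fin n} {v : β → M}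
    {xs : Fin n → M} :
    (substVar g φ).Realize v xs ↔ φ.Realize fun a => Sum.elim v xs (g a) := by
  exact Language.BoundedFormula.realize_relabel.trans
    (iff_of_eq (congrArg (Language.BoundedFormula.Realize φ _) (Subsingleton.elim _ _)))

end Connectives

/-- A variable seen under one more quantifier. -/
def liftVar {β : Type} {n : ℕ} : β ⊕ Fin n → β ⊕ Fin (n + 1) := Sum.map id Fin.castSucc

@[simp]
theorem elim_liftVar {β M : Type} {n : ℕ} (v : β → M) (xs : Fin n → M) (a : M) (t : β ⊕ Fin n) :
    Sum.elim v (Fin.snoc xs a : Fin (n + 1) → M) (liftVar t) = Sum.elim v xs t := by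
  rcases t with t | t <;> simp [liftVar]

/-- A first-order specification, over words, of a graph whose vertices are pairs of a copy in
`Fin q` and a position. A vertex exists when one of its labelling formulas holds; the labels are
words. -/
structure GraphSpec (A B : Type) (q : ℕ) where
  /-- the domain formula -/
  dom : (wordLang A).Sentence
  /-- the possible labels of each copy, with the formulas that select them -/
  lab : Fin q → List (List B × (wordLang A).Formula (Fin 1))
  /-- the order formulas -/
  ord : Fin q → Fin q → (wordLang A).Formula (Fin 2)

namespace GraphSpec

variable {A B : Type} {q : ℕ} (G : GraphSpec A B q)

/-- The vertex `x` has label `o`. -/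
def Label (w : List A) (x : Fin q × Pos w) (o : List B) : Prop :=
  ∃ e ∈ G.lab x.1, e.1 = o ∧ Sat₁ w e.2 x.2

/-- `x` is a vertex of the graph over `w`. -/
def Node (w : List A) (x : Fin q × Pos w) : Prop := ∃ e ∈ G.lab x.1, Sat₁ w e.2 x.2

/-- The order relation of the graph over `w`. -/
def Le (w : List A) (x y : Fin q × Pos w) : Prop := Sat₂ w (G.ord x.1 y.1) x.2 y.2

/-- The domain formula holds and the graph is linearly ordered. -/
def IsLinear (w : List A) : Prop :=
  Language.Sentence.Realize (Pos w) G.dom ∧ IsLinearOn (G.Node w) (G.Le w)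

/-- At most one labelling formula of each copy holds at each position. -/
def Exclusive (w : List A) : Prop :=
  ∀ (s : Fin q) (i : Pos w), ∀ e ∈ G.lab s, ∀ e' ∈ G.lab s,
    Sat₁ w e.2 i → Sat₁ w e'.2 i → e = e'

section Formulas

variable {β : Type} {n : ℕ} {w : List A} {v : β → Pos w} {xs : Fin n → Pos w}

/-- `(s, t)` is a vertex. -/
def nodeFormula (s : Fin q) (t : β ⊕ Fin n) : (wordLang A).BoundedFormula β n :=
  disj ((G.lab s).map fun e => substVar (fun _ => t) e.2)

/-- `(s, t) ≤ (s', t')`. -/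
def leFormula (s s' : Fin q) (t t' : β ⊕ Fin n) : (wordLang A).BoundedFormula β n :=
  substVar ![t, t'] (G.ord s s')

/-- `(s', t')` is the successor of `(s, t)`. -/
def nextFormula (s s' : Fin q) (t t' : β ⊕ Fin n) : (wordLang A).BoundedFormula β n :=
  conj [G.nodeFormula s' t', (G.leFormula s' s t' t).not,
    (conj ((List.finRange q).map fun r =>
      (G.nodeFormula r (Sum.inr (Fin.last n))).imp
        (disj [G.leFormula r s (Sum.inr (Fin.last n)) (liftVar t),
          G.leFormula s' r (liftVar t') (Sum.inr (Fin.last n))]))).all]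

/-- The conditions of a linear order for the vertices `(s₁, x)`, `(s₂, y)`, `(s₃, z)`, where `x`,
`y`, `z` are the first three bound variables. -/
def linearAtFormula (s₁ s₂ s₃ : Fin q) : (wordLang A).BoundedFormula β 3 :=
  (G.nodeFormula s₁ (Sum.inr 0)).imp ((G.nodeFormula s₂ (Sum.inr 1)).imp
    ((G.nodeFormula s₃ (Sum.inr 2)).imp (conj
      [disj [G.leFormula s₁ s₂ (Sum.inr 0) (Sum.inr 1), G.leFormula s₂ s₁ (Sum.inr 1) (Sum.inr 0)],
        (G.leFormula s₁ s₂ (Sum.inr 0) (Sum.inr 1)).imp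
          ((G.leFormula s₂ s₃ (Sum.inr 1) (Sum.inr 2)).imp
            (G.leFormula s₁ s₃ (Sum.inr 0) (Sum.inr 2))),
        (G.leFormula s₁ s₂ (Sum.inr 0) (Sum.inr 1)).imp
          ((G.leFormula s₂ s₁ (Sum.inr 1) (Sum.inr 0)).imp
            (if s₁ = s₂ then .equal (.var (Sum.inr 0)) (.var (Sum.inr 1)) else ⊥))])))

variable (β) in
/-- The domain formula holds and the graph is linearly ordered. -/
def linearFormula : (wordLang A).Formula β :=
  conj [substVar Empty.elim G.dom,
    (conj ((List.finRange q).flatMap fun s₁ => (List.finRange q).flatMap fun s₂ =>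
      (List.finRange q).map fun s₃ => G.linearAtFormula s₁ s₂ s₃)).all.all.all]

@[simp]
theorem realize_nodeFormula {s : Fin q} {t : β ⊕ Fin n} :
    (G.nodeFormula s t).Realize v xs ↔ G.Node w (s, Sum.elim v xs t) := by
  simp only [nodeFormula, realize_disj, List.mem_map, exists_exists_and_eq_and,
    realize_substVar, Node, Sat₁]
  have : (fun _ : Fin 1 => Sum.elim v xs t) = ![Sum.elim v xs t] := by
    ext i; fin_cases i; rfl
  rw [this]

@[simp]
theorem realize_leFormula {s s' : Fin q} {t t' : β ⊕ Fin n} :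
    (G.leFormula s s' t t').Realize v xs ↔
      G.Le w (s, Sum.elim v xs t) (s', Sum.elim v xs t') := by
  simp only [leFormula, realize_substVar, Le, Sat₂]
  have : (fun i => Sum.elim v xs (![t, t'] i)) = ![Sum.elim v xs t, Sum.elim v xs t'] := by
    ext i; fin_cases i <;> rfl
  rw [this]

@[simp]
theorem realize_nextFormula {s s' : Fin q} {t t' : β ⊕ Fin n} :
    (G.nextFormula s s' t t').Realize v xs ↔
      IsNext (G.Node w) (G.Le w) (s, Sum.elim v xs t) (s', Sum.elim v xs t') := by
  simp only [nextFormula, realize_conj, List.forall_mem_cons, realize_nodeFormula,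
    Language.BoundedFormula.realize_not, realize_leFormula, Language.BoundedFormula.realize_all,
    List.forall_mem_map, List.mem_finRange, forall_const, Language.BoundedFormula.realize_imp,
    realize_disj, List.exists_mem_cons_iff, elim_liftVar, Sum.elim_inr, Fin.snoc_last, IsNext,
    Prod.forall, List.not_mem_nil, false_imp_iff, and_true, false_and, exists_false, or_false]
  exact and_congr Iff.rfl (and_congr Iff.rfl forall_comm)

theorem realize_all_all_all {L : Language} {M : Type} [L.Structure M]
    {φ : L.BoundedFormula β 3} {v : β → M} :
    φ.all.all.all.Realize v default ↔ ∀ x y z, φ.Realize v ![x, y, z] := by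
  simp only [Language.BoundedFormula.realize_all]
  refine forall_congr' fun x => forall_congr' fun y => forall_congr' fun z => ?_
  have : (Fin.snoc (Fin.snoc (Fin.snoc (default : Fin 0 → M) x : Fin 1 → M) y : Fin 2 → M) z :
      Fin 3 → M) = ![x, y, z] := by
    ext i; fin_cases i <;> rfl
  rw [← this]

theorem realize_linearAtFormula {s₁ s₂ s₃ : Fin q} {x y z : Pos w} :
    (G.linearAtFormula s₁ s₂ s₃).Realize v ![x, y, z] ↔
      (G.Node w (s₁, x) → G.Node w (s₂, y) → G.Node w (s₃, z) →
        (G.Le w (s₁, x) (s₂, y) ∨ G.Le w (s₂, y) (s₁, x)) ∧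
        (G.Le w (s₁, x) (s₂, y) → G.Le w (s₂, y) (s₃, z) → G.Le w (s₁, x) (s₃, z)) ∧
        (G.Le w (s₁, x) (s₂, y) → G.Le w (s₂, y) (s₁, x) → (s₁, x) = (s₂, y))) := by
  have : (if s₁ = s₂ then Language.BoundedFormula.equal (.var (Sum.inr 0)) (.var (Sum.inr 1))
      else ⊥ : (wordLang A).BoundedFormula β 3).Realize v ![x, y, z] ↔ (s₁, x) = (s₂, y) := by
    split_ifs with h
    · subst h
      simp only [Prod.mk.injEq, true_and]
      exact Iff.rfl
    · simp [h]
  simp [linearAtFormula, this]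

theorem realize_linearFormula {v : β → Pos w} :
    (G.linearFormula β).Realize v ↔ G.IsLinear w := by
  rw [Language.Formula.Realize, linearFormula, realize_conj]
  simp only [List.forall_mem_cons, realize_all_all_all, realize_conj, List.not_mem_nil,
    false_imp_iff, implies_true, and_true, realize_substVar]
  refine and_congr ?_ ?_
  · rw [Language.Sentence.Realize, Subsingleton.elim (fun a => Sum.elim v default _) default]
  · simp only [List.forall_mem_flatMap, List.forall_mem_map, List.mem_finRange, forall_const,
      realize_linearAtFormula]
    constructor
    · intro h
      exact ⟨fun x y hx hy => (h x.2 y.2 x.2 x.1 y.1 x.1 hx hy hx).1,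
        fun x y z hx hy hz => (h x.2 y.2 z.2 x.1 y.1 z.1 hx hy hz).2.1,
        fun x y hx hy => (h x.2 y.2 x.2 x.1 y.1 x.1 hx hy hx).2.2⟩
    · intro h x y z s₁ s₂ s₃ hx hy hz
      exact ⟨h.total _ _ hx hy, h.trans _ _ _ hx hy hz, h.antisymm _ _ hx hy⟩

end Formulas

/-! ### The transducer that follows a linear order -/

/-- The test of the transition that reads the label formula `φ` in copy `s` and moves to copy
`s'`. -/
def testFormula (s s' : Fin q) (φ : (wordLang A).Formula (Fin 1)) :
    (wordLang A).Formula (Fin 1) :=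
  -- the linearity conjunct disables every transition where the output is undefined
  conj [G.linearFormula (Fin 1), φ, (G.nextFormula s s' (Sum.inl 0) (Sum.inr 0)).ex]

/-- The movement from a vertex in copy `s` to its successor in copy `s'`. -/
def moveFormula (s s' : Fin q) : (wordLang A).Formula (Fin 2) :=
  conj [G.linearFormula (Fin 2), G.nextFormula (n := 0) s s' (Sum.inl 0) (Sum.inl 1)]

variable {w : List A}

theorem sat_testFormula {s s' : Fin q} {φ : (wordLang A).Formula (Fin 1)} {i : Pos w} :
    Sat₁ w (G.testFormula s s' φ) i ↔
      G.IsLinear w ∧ Sat₁ w φ i ∧ ∃ j, IsNext (G.Node w) (G.Le w) (s, i) (s', j) := by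
  have h := G.realize_linearFormula (v := ![i])
  rw [Language.Formula.Realize] at h
  rw [Sat₁, Language.Formula.Realize, testFormula, realize_conj]
  simp only [List.forall_mem_cons, h, Language.BoundedFormula.realize_ex, realize_nextFormula,
    Sum.elim_inl, Sum.elim_inr, List.not_mem_nil, false_imp_iff, implies_true, and_true]
  exact Iff.rfl

theorem sat_moveFormula {s s' : Fin q} {i j : Pos w} :
    Sat₂ w (G.moveFormula s s') i j ↔
      G.IsLinear w ∧ IsNext (G.Node w) (G.Le w) (s, i) (s', j) := by
  have h := G.realize_linearFormula (v := ![i, j])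
  rw [Language.Formula.Realize] at h
  rw [Sat₂, Language.Formula.Realize, moveFormula, realize_conj]
  simp only [List.forall_mem_cons, h, realize_nextFormula,
    Sum.elim_inl, List.not_mem_nil, false_imp_iff, implies_true, and_true]
  exact Iff.rfl

end GraphSpec

namespace GraphSpec

variable {A B : Type} {q : ℕ} (G : GraphSpec (Marked A) B q)

/-- The two-way transducer whose states are the copies of `G` and whose head moves from each
vertex to its successor, producing the label of the vertex that it leaves. -/
def toTransducer (init final : Fin q) : Transducer A B (Fin q) where
  trans := (List.finRange q).flatMap fun s => (G.lab s).flatMap fun e =>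
    (List.finRange q).map fun s' =>
      ⟨s, G.testFormula s s' e.2, s', e.1, G.moveFormula s s'⟩
  init := init
  final := {final}

variable {G} {init final : Fin q}

theorem mem_trans {t : Transition A B (Fin q)} :
    t ∈ (G.toTransducer init final).trans ↔ ∃ s s', ∃ e ∈ G.lab s,
      t = ⟨s, G.testFormula s s' e.2, s', e.1, G.moveFormula s s'⟩ := by
  simp only [toTransducer, List.mem_flatMap, List.mem_map, List.mem_finRange, true_and]
  constructor
  · rintro ⟨s, e, he, s', rfl⟩
    exact ⟨s, s', e, he, rfl⟩
  · rintro ⟨s, s', e, he, rfl⟩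
    exact ⟨s, e, he, s', rfl⟩

/-- The linearity conjunct of the test is what makes the description of a step uniform: where the
graph is not linearly ordered there is no step at all. -/
theorem step_iff {u : List A} {x y : Fin q × Pos (mark u)} {o : List B} :
    (G.toTransducer init final).Step u x o y ↔ G.IsLinear (mark u) ∧ G.Label (mark u) x o ∧
      IsNext (G.Node (mark u)) (G.Le (mark u)) x y := by
  constructor
  · rintro ⟨t, ht, h1, h2, h3, h4, h5⟩
    obtain ⟨s, s', e, he, rfl⟩ := mem_trans.1 ht
    obtain ⟨x1, x2⟩ := x
    obtain ⟨y1, y2⟩ := y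
    dsimp only at h1 h3 h4
    subst h1 h3 h4
    rw [sat_moveFormula] at h5
    rw [sat_testFormula] at h2
    exact ⟨h5.1, ⟨e, he, rfl, h2.2.1⟩, h5.2⟩
  · rintro ⟨h1, ⟨e, he, rfl, h2⟩, h3⟩
    exact ⟨_, mem_trans.2 ⟨x.1, y.1, e, he, rfl⟩, rfl,
      (G.sat_testFormula).2 ⟨h1, h2, y.2, h3⟩, rfl, rfl, (G.sat_moveFormula).2 ⟨h1, h3⟩⟩

theorem deterministic_toTransducer (hG : ∀ u : List A, G.Exclusive (mark u)) :
    (G.toTransducer init final).Deterministic := by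
  constructor
  · intro u i t ht t' ht' hs h h'
    obtain ⟨s, r, e, he, rfl⟩ := mem_trans.1 ht
    obtain ⟨s', r', e', he', rfl⟩ := mem_trans.1 ht'
    dsimp only at hs h h'
    subst hs
    rw [sat_testFormula] at h h'
    obtain ⟨hl, h1, j, h2⟩ := h
    obtain ⟨-, h1', j', h2'⟩ := h'
    obtain rfl := hG u s i e he e' he' h1 h1'
    have := hl.2.isNext_unique h2 h2'
    obtain rfl : r = r' := congrArg Prod.fst this
    rfl
  · intro u i j j' t ht h h'
    obtain ⟨s, r, e, he, rfl⟩ := mem_trans.1 ht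
    dsimp only at h h'
    rw [sat_moveFormula] at h h'
    exact congrArg Prod.snd (h.1.2.isNext_unique h.2 h'.2)

end GraphSpec
namespace GraphSpec

variable {A B : Type} {q : ℕ} {G : GraphSpec (Marked A) B q} {init final : Fin q} {u : List A}

/-- The label produced by a step is that of its source, so the last vertex `y` contributes none. -/
theorem isRun_of_isChain (hl : G.IsLinear (mark u)) {y : Fin q × Pos (mark u)} :
    ∀ {ms : List (Fin q × Pos (mark u))} {os : List (List B)},
      (ms ++ [y]).IsChain (IsNext (G.Node (mark u)) (G.Le (mark u))) →
      List.Forall₂ (G.Label (mark u)) ms os →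
      (G.toTransducer init final).IsRun u (ms ++ [y]) os.flatten
  | [], _, _, .nil => .single y
  | [_], _, h, .cons hx .nil =>
    .cons (step_iff.2 ⟨hl, hx, by simpa using h⟩) (.single y)
  | x :: z :: ms, _, h, .cons hx ho => by
    obtain ⟨h1, h2⟩ := List.isChain_cons_cons.1 h
    exact .cons (step_iff.2 ⟨hl, hx, h1⟩) (isRun_of_isChain hl (ms := z :: ms) h2 ho)

end GraphSpec

/-- Two runs of a deterministic transducer from the same configuration that cannot be continued
coincide. -/
theorem Transducer.IsRun.unique {A B Q : Type} {M : Transducer A B Q} (hM : M.Deterministic)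
    {u : List A} {r r' : List (Q × Pos (mark u))} {v v' : List B}
    (h : M.IsRun u r v) (h' : M.IsRun u r' v') (hh : r.head? = r'.head?)
    (ht : ∀ x ∈ r.getLast?, ∀ o y, ¬ M.Step u x o y)
    (ht' : ∀ x ∈ r'.getLast?, ∀ o y, ¬ M.Step u x o y) : r = r' ∧ v = v' := by
  induction h generalizing r' v' with
  | single x =>
    cases h' with
    | single x' => exact ⟨by simpa using hh, rfl⟩
    | cons hs _ =>
      obtain rfl : x = _ := by simpa using hh
      exact absurd hs (ht x (by simp) _ _)
  | @cons x y r o v hs hr ih =>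
    cases h' with
    | single x' =>
      obtain rfl : x = x' := by simpa using hh
      exact absurd hs (ht' x (by simp) _ _)
    | @cons x' y' r' o' v' hs' hr' =>
      obtain rfl : x = x' := by simpa using hh
      obtain ⟨t, ht1, hsrc, htest, hdst, hout, hmove⟩ := hs
      obtain ⟨t', ht1', hsrc', htest', hdst', hout', hmove'⟩ := hs'
      obtain rfl := hM.1 u _ t ht1 t' ht1' (hsrc.trans hsrc'.symm) htest htest'
      obtain rfl : y = y' :=
        Prod.ext (hdst.symm.trans hdst') (hM.2 u _ _ _ t ht1 hmove hmove')
      obtain ⟨h1, rfl⟩ := ih hr' rfl (by simpa using ht) (by simpa using ht')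
      exact ⟨by rw [h1], by rw [← hout, ← hout']⟩

/-! ### Relativization to the positions that carry a letter -/

section Relativize

variable {A : Type}

@[simp]
theorem length_mark (u : List A) : (mark u).length = u.length + 2 := by
  simp [mark]

/-- The position of `⊢ u ⊣` that corresponds to a position of `u`. -/
def shiftPos {u : List A} (i : Pos u) : Pos (mark u) :=
  ⟨i.val + 1, by rw [length_mark]; have := i.isLt; omega⟩

/-- The position of `⊢`. -/
def leftPos (u : List A) : Pos (mark u) := ⟨0, by simp⟩

/-- The position of `⊣`. -/
def rightPos (u : List A) : Pos (mark u) := ⟨u.length + 1, by simp⟩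

theorem shiftPos_injective {u : List A} : Function.Injective (shiftPos (u := u)) :=
  fun i j h => Fin.ext (by simpa [shiftPos] using h)

theorem pos_mark_cases {u : List A} (p : Pos (mark u)) :
    p = leftPos u ∨ (∃ i, p = shiftPos i) ∨ p = rightPos u := by
  obtain ⟨p, hp⟩ := p
  have hp' := hp
  rw [length_mark] at hp'
  rcases Nat.eq_zero_or_pos p with h | h
  · exact Or.inl (Fin.ext h)
  · rcases Nat.lt_or_ge p (u.length + 1) with h1 | h1
    · exact Or.inr (Or.inl ⟨⟨p - 1, by omega⟩, Fin.ext (by simp only [shiftPos]; omega)⟩)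
    · exact Or.inr (Or.inr (Fin.ext (by simp only [rightPos]; omega)))

@[simp]
theorem get_leftPos (u : List A) : (mark u).get (leftPos u) = Marked.left := rfl

@[simp]
theorem get_shiftPos {u : List A} (i : Pos u) :
    (mark u).get (shiftPos i) = Marked.letter (u.get i) := by
  simp [mark, shiftPos]

@[simp]
theorem get_rightPos (u : List A) : (mark u).get (rightPos u) = Marked.right := by
  simp [mark, rightPos]

theorem get_eq_left_iff {u : List A} {p : Pos (mark u)} :
    (mark u).get p = Marked.left ↔ p = leftPos u := by
  refine ⟨fun h => ?_, fun h => by rw [h, get_leftPos]⟩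
  rcases pos_mark_cases p with rfl | ⟨i, rfl⟩ | rfl
  · rfl
  · rw [get_shiftPos] at h; cases h
  · rw [get_rightPos] at h; cases h

theorem get_eq_right_iff {u : List A} {p : Pos (mark u)} :
    (mark u).get p = Marked.right ↔ p = rightPos u := by
  refine ⟨fun h => ?_, fun h => by rw [h, get_rightPos]⟩
  rcases pos_mark_cases p with rfl | ⟨i, rfl⟩ | rfl
  · cases h
  · rw [get_shiftPos] at h; cases h
  · rfl

theorem exists_shiftPos_iff {u : List A} {p : Pos (mark u)} :
    (∃ i, p = shiftPos i) ↔ p ≠ leftPos u ∧ p ≠ rightPos u := by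
  constructor
  · rintro ⟨i, rfl⟩
    constructor
    · intro h
      simp [shiftPos, leftPos] at h
    · intro h
      have := i.isLt
      simp only [shiftPos, rightPos, Fin.mk.injEq] at h
      omega
  · rintro ⟨h1, h2⟩
    exact ((pos_mark_cases p).resolve_left h1).resolve_right h2

variable {α : Type}

/-- The variable `t` is at a position labelled `a`. -/
def letterFormula {n : ℕ} (a : A) (t : α ⊕ Fin n) : (wordLang A).BoundedFormula α n :=
  .rel (WordRel.letter a : (wordLang A).Relations 1) fun _ => .var t

@[simp]
theorem realize_letterFormula {n : ℕ} {a : A} {t : α ⊕ Fin n} {w : List A} {f : α → Pos w}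
    {xs : Fin n → Pos w} :
    (letterFormula a t).Realize f xs ↔ w.get (Sum.elim f xs t) = a :=
  Iff.rfl

/-- Words have no function symbols, so that terms do not depend on the alphabet. -/
def markTerm : (wordLang A).Term α → (wordLang (Marked A)).Term α
  | .var x => .var x
  | .func g _ => Empty.elim g

/-- The formula over `⊢ u ⊣` that says of the letter positions what `φ` says of `u`: quantifiers
are relativized to the positions that carry a letter. -/
def relativize : {n : ℕ} → (wordLang A).BoundedFormula α n →
    (wordLang (Marked A)).BoundedFormula α n
  | _, .falsum => .falsum
  | _, .equal s t => .equal (markTerm s) (markTerm t)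
  | _, .rel R ts => match R, ts with
    | WordRel.letter a, ts =>
      .rel (WordRel.letter (Marked.letter a) : (wordLang (Marked A)).Relations 1)
        fun i => markTerm (ts i)
    | WordRel.lt, ts =>
      .rel (WordRel.lt : (wordLang (Marked A)).Relations 2) fun i => markTerm (ts i)
  | _, .imp φ ψ => .imp (relativize φ) (relativize ψ)
  | n, .all φ => .all ((letterFormula Marked.left (Sum.inr (Fin.last n))).not.imp
      ((letterFormula Marked.right (Sum.inr (Fin.last n))).not.imp (relativize φ)))

theorem realize_markTerm {u : List A} {f : α → Pos u} (t : (wordLang A).Term α) :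
    (markTerm t).realize (shiftPos ∘ f) = shiftPos (t.realize f) := by
  rcases t with x | ⟨g, _⟩
  · rfl
  · exact g.elim

theorem realize_relativize {n : ℕ} {u : List A} (φ : (wordLang A).BoundedFormula α n)
    (f : α → Pos u) (xs : Fin n → Pos u) :
    (relativize φ).Realize (shiftPos ∘ f) (shiftPos ∘ xs) ↔ φ.Realize f xs := by
  induction φ with
  | falsum => exact Iff.rfl
  | equal s t =>
    simp only [relativize, Language.BoundedFormula.Realize, ← Sum.comp_elim, realize_markTerm,
      shiftPos_injective.eq_iff]
  | rel R ts =>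
    cases R with
    | letter a =>
      simp only [relativize, Language.BoundedFormula.Realize, ← Sum.comp_elim, realize_markTerm]
      change (mark u).get _ = Marked.letter a ↔ u.get _ = a
      rw [get_shiftPos, Marked.letter.injEq]
    | lt =>
      simp only [relativize, Language.BoundedFormula.Realize, ← Sum.comp_elim, realize_markTerm]
      exact Nat.add_lt_add_iff_right
  | imp φ ψ ihφ ihψ => exact imp_congr (ihφ xs) (ihψ xs)
  | all φ ih =>
    simp only [relativize, Language.BoundedFormula.realize_all, Language.BoundedFormula.realize_imp,
      Language.BoundedFormula.realize_not, realize_letterFormula, Sum.elim_inr, Fin.snoc_last,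
      get_eq_left_iff, get_eq_right_iff]
    constructor
    · intro h i
      obtain ⟨h1, h2⟩ := exists_shiftPos_iff.1 ⟨i, rfl⟩
      rw [← ih, Fin.comp_snoc]
      exact h _ h1 h2
    · intro h p h1 h2
      obtain ⟨i, rfl⟩ := exists_shiftPos_iff.2 ⟨h1, h2⟩
      rw [← Fin.comp_snoc, ih]
      exact h i

theorem sat₁_relativize {u : List A} {φ : (wordLang A).Formula (Fin 1)} {i : Pos u} :
    Sat₁ (mark u) (relativize φ) (shiftPos i) ↔ Sat₁ u φ i := by
  rw [Sat₁, Sat₁, Language.Formula.Realize, Language.Formula.Realize,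
    ← realize_relativize φ ![i] default, Subsingleton.elim (shiftPos ∘ default) default]
  have : (shiftPos ∘ ![i] : Fin 1 → Pos (mark u)) = ![shiftPos i] := by
    ext j; fin_cases j; rfl
  rw [this]

theorem sat₂_relativize {u : List A} {φ : (wordLang A).Formula (Fin 2)} {i j : Pos u} :
    Sat₂ (mark u) (relativize φ) (shiftPos i) (shiftPos j) ↔ Sat₂ u φ i j := by
  rw [Sat₂, Sat₂, Language.Formula.Realize, Language.Formula.Realize,
    ← realize_relativize φ ![i, j] default, Subsingleton.elim (shiftPos ∘ default) default]
  have : (shiftPos ∘ ![i, j] : Fin 2 → Pos (mark u)) = ![shiftPos i, shiftPos j] := by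
    ext j; fin_cases j <;> rfl
  rw [this]

theorem realize_relativize_sentence {u : List A} {φ : (wordLang A).Sentence} :
    Language.Sentence.Realize (Pos (mark u)) (relativize φ) ↔
      Language.Sentence.Realize (Pos u) φ := by
  rw [Language.Sentence.Realize, Language.Sentence.Realize, Language.Formula.Realize,
    Language.Formula.Realize, ← realize_relativize φ default default,
    Subsingleton.elim (shiftPos ∘ (default : Fin 0 → Pos u)) default,
    Subsingleton.elim (shiftPos ∘ (default : Empty → Pos u)) default]

end Relativize

/-! ### The output order of a transduction, completed by the endmarkers -/

namespace Transduction

variable {A : Type} {b k : ℕ}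

/-- The initial copy of the completed graph. -/
abbrev initCopy (k : ℕ) : Fin (k + 2) := Fin.natAdd k 0

/-- The final copy of the completed graph. -/
abbrev finalCopy (k : ℕ) : Fin (k + 2) := Fin.natAdd k 1

theorem copy_cases (s : Fin (k + 2)) :
    (∃ c : Fin k, s = Fin.castAdd 2 c) ∨ s = initCopy k ∨ s = finalCopy k := by
  refine Fin.addCases (fun c => Or.inl ⟨c, rfl⟩) (fun j => ?_) s
  fin_cases j
  · exact Or.inr (Or.inl rfl)
  · exact Or.inr (Or.inr rfl)

theorem castAdd_ne_natAdd (c : Fin k) (j : Fin 2) : Fin.castAdd 2 c ≠ Fin.natAdd k j := fun h => by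
  have := congrArg Fin.val h
  simp only [Fin.val_castAdd, Fin.val_natAdd] at this
  omega

/-- The output graph of `T` seen over `⊢ u ⊣`, with two unlabelled vertices added: a least one at
`⊢` in copy `k` and a greatest one at `⊣` in copy `k + 1`. -/
def markedSpec (T : Transduction A (Fin b) (Fin k)) : GraphSpec (Marked A) (Fin b) (k + 2) where
  dom := relativize T.dom
  lab s :=
    if h : s.val < k then
      (List.finRange b).map fun x =>
        ([x], conj [(letterFormula Marked.left (Sum.inl 0)).not,
          (letterFormula Marked.right (Sum.inl 0)).not, relativize (T.pos ⟨s, h⟩ x)])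
    else if s.val = k then [([], letterFormula Marked.left (Sum.inl 0))]
    else [([], letterFormula Marked.right (Sum.inl 0))]
  ord s s' :=
    if s'.val = k + 1 ∨ s.val = k then (⊥ : (wordLang (Marked A)).Formula (Fin 2)).not
    else if h : s.val < k ∧ s'.val < k then relativize (T.ord ⟨s, h.1⟩ ⟨s', h.2⟩)
    else ⊥

/-- The vertex of the completed graph that corresponds to a vertex of the output graph. -/
def markedVertex {u : List A} (x : Fin k × Pos u) : Fin (k + 2) × Pos (mark u) :=
  (Fin.castAdd 2 x.1, shiftPos x.2)

/-- The vertices of the completed graph, for `ns` the vertices of the output graph. -/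
def markedVertices {u : List A} (ns : List (Fin k × Pos u)) : List (Fin (k + 2) × Pos (mark u)) :=
  ((initCopy k, leftPos u) :: ns.map markedVertex) ++ [(finalCopy k, rightPos u)]

theorem markedVertex_injective {u : List A} :
    Function.Injective (markedVertex (k := k) (u := u)) := by
  rintro ⟨c, i⟩ ⟨c', i'⟩ h
  rw [markedVertex, markedVertex, Prod.mk.injEq] at h
  rw [Prod.mk.injEq]
  exact ⟨Fin.castAdd_injective _ _ h.1, shiftPos_injective h.2⟩

variable (T : Transduction A (Fin b) (Fin k)) {u : List A}

theorem exclusive_markedSpec : T.markedSpec.Exclusive (mark u) := by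
  intro s p e he e' he' h h'
  rcases copy_cases s with ⟨c, rfl⟩ | rfl | rfl
  · simp only [markedSpec, Fin.val_castAdd, c.isLt, dif_pos, List.mem_map, List.mem_finRange,
      true_and] at he he'
    obtain ⟨x, rfl⟩ := he
    obtain ⟨x', rfl⟩ := he'
    rw [Sat₁, Language.Formula.Realize, realize_conj] at h h'
    simp only [List.forall_mem_cons, Language.BoundedFormula.realize_not, realize_letterFormula,
      Sum.elim_inl, Matrix.cons_val_fin_one, get_eq_left_iff, get_eq_right_iff] at h h'
    obtain ⟨i, rfl⟩ := exists_shiftPos_iff.2 ⟨h.1, h.2.1⟩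
    obtain rfl := T.pos_exclusive u c i x x' (sat₁_relativize.1 h.2.2.1)
      (sat₁_relativize.1 h'.2.2.1)
    rfl
  · simp [markedSpec] at he he'
    rw [he, he']
  · simp [markedSpec] at he he'
    rw [he, he']

theorem label_markedSpec_castAdd {c : Fin k} {p : Pos (mark u)} {o : List (Fin b)} :
    T.markedSpec.Label (mark u) (Fin.castAdd 2 c, p) o ↔
      ∃ i, p = shiftPos i ∧ ∃ x, T.Label u (c, i) x ∧ o = [x] := by
  simp only [GraphSpec.Label, markedSpec, Fin.val_castAdd, c.isLt, dif_pos, List.mem_map,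
    List.mem_finRange, true_and, exists_exists_eq_and]
  have : ∀ x, Sat₁ (mark u) (conj [(letterFormula Marked.left (Sum.inl 0)).not,
      (letterFormula Marked.right (Sum.inl 0)).not, relativize (T.pos c x)]) p ↔
      ∃ i, p = shiftPos i ∧ T.Label u (c, i) x := by
    intro x
    rw [Sat₁, Language.Formula.Realize, realize_conj]
    simp only [List.forall_mem_cons, Language.BoundedFormula.realize_not, realize_letterFormula,
      Sum.elim_inl, Matrix.cons_val_fin_one, get_eq_left_iff, get_eq_right_iff, List.not_mem_nil,
      false_imp_iff, implies_true, and_true]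
    constructor
    · rintro ⟨h1, h2, h3⟩
      obtain ⟨i, rfl⟩ := exists_shiftPos_iff.2 ⟨h1, h2⟩
      exact ⟨i, rfl, sat₁_relativize.1 h3⟩
    · rintro ⟨i, rfl, h⟩
      obtain ⟨h1, h2⟩ := exists_shiftPos_iff.1 ⟨i, rfl⟩
      exact ⟨h1, h2, sat₁_relativize.2 h⟩
  constructor
  · rintro ⟨x, rfl, hx⟩
    obtain ⟨i, hi, h⟩ := (this x).1 hx
    exact ⟨i, hi, x, h, rfl⟩
  · rintro ⟨i, hi, x, hx, rfl⟩
    exact ⟨x, rfl, (this x).2 ⟨i, hi, hx⟩⟩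

theorem label_markedSpec_init {p : Pos (mark u)} {o : List (Fin b)} :
    T.markedSpec.Label (mark u) (initCopy k, p) o ↔ p = leftPos u ∧ o = [] := by
  simp only [GraphSpec.Label, markedSpec, initCopy, Fin.val_natAdd, Fin.val_zero, add_zero,
    lt_irrefl, dif_neg, not_false_eq_true, if_pos, List.mem_singleton, exists_eq_left]
  rw [and_comm, eq_comm (a := ([] : List (Fin b))), ← get_eq_left_iff]
  exact Iff.rfl

theorem label_markedSpec_final {p : Pos (mark u)} {o : List (Fin b)} :
    T.markedSpec.Label (mark u) (finalCopy k, p) o ↔ p = rightPos u ∧ o = [] := by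
  simp only [GraphSpec.Label, markedSpec, finalCopy, Fin.val_natAdd, Fin.val_one,
    Nat.succ_ne_self, dif_neg, not_false_eq_true, if_neg, List.mem_singleton, exists_eq_left,
    Nat.not_succ_lt_self]
  rw [and_comm, eq_comm (a := ([] : List (Fin b))), ← get_eq_right_iff]
  exact Iff.rfl

theorem node_markedSpec_iff {x : Fin (k + 2) × Pos (mark u)} :
    T.markedSpec.Node (mark u) x ↔ x = (initCopy k, leftPos u) ∨
      (∃ y, T.IsNode u y ∧ x = markedVertex y) ∨ x = (finalCopy k, rightPos u) := by
  have hx : T.markedSpec.Node (mark u) x ↔ ∃ o, T.markedSpec.Label (mark u) x o := by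
    simp only [GraphSpec.Node, GraphSpec.Label]
    constructor
    · rintro ⟨e, he, h⟩
      exact ⟨e.1, e, he, rfl, h⟩
    · rintro ⟨o, e, he, -, h⟩
      exact ⟨e, he, h⟩
  obtain ⟨s, p⟩ := x
  rw [hx]
  rcases copy_cases s with ⟨c, rfl⟩ | rfl | rfl
  · simp only [label_markedSpec_castAdd, Prod.mk.injEq, castAdd_ne_natAdd, false_and, false_or, or_false,
      markedVertex, (Fin.castAdd_injective k 2).eq_iff, Prod.exists, IsNode]
    constructor
    · rintro ⟨o, i, rfl, y, hy, -⟩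
      exact ⟨c, i, ⟨y, hy⟩, rfl, rfl⟩
    · rintro ⟨c', i, ⟨y, hy⟩, rfl, rfl⟩
      exact ⟨_, i, rfl, y, hy, rfl⟩
  · simp [label_markedSpec_init, markedVertex, (castAdd_ne_natAdd _ _).symm]
  · simp [label_markedSpec_final, markedVertex, (castAdd_ne_natAdd _ _).symm]

theorem le_markedSpec_markedVertex {x y : Fin k × Pos u} :
    T.markedSpec.Le (mark u) (markedVertex x) (markedVertex y) ↔ T.Le u x y := by
  have h1 : ¬ (y.1.val = k + 1 ∨ x.1.val = k) := by
    have := x.1.isLt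
    have := y.1.isLt
    omega
  simp only [GraphSpec.Le, markedSpec, markedVertex, Fin.val_castAdd, h1, if_false, x.1.isLt,
    y.1.isLt, and_self, dif_pos]
  exact sat₂_relativize

theorem le_markedSpec_of_eq {x y : Fin (k + 2) × Pos (mark u)}
    (h : y.1 = finalCopy k ∨ x.1 = initCopy k) : T.markedSpec.Le (mark u) x y := by
  have h' : y.1.val = k + 1 ∨ x.1.val = k :=
    h.imp (fun h => by rw [h]; rfl) fun h => by rw [h]; rfl
  simp only [GraphSpec.Le, markedSpec, h', if_true]
  exact id

theorem not_le_markedSpec_init {x y : Fin (k + 2) × Pos (mark u)} (hy : y.1 = initCopy k)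
    (hx : x.1 ≠ initCopy k) : ¬ T.markedSpec.Le (mark u) x y := by
  have hy' : y.1.val = k := by rw [hy]; rfl
  have hx' : x.1.val ≠ k := fun h => hx (Fin.ext h)
  simp only [GraphSpec.Le, markedSpec, hy', hx', lt_irrefl, and_false, dif_neg,
    not_false_eq_true, or_false, left_eq_add, one_ne_zero, if_false]
  exact id

theorem not_le_markedSpec_final {x y : Fin (k + 2) × Pos (mark u)} (hx : x.1 = finalCopy k)
    (hy : y.1 ≠ finalCopy k) : ¬ T.markedSpec.Le (mark u) x y := by
  have hx' : x.1.val = k + 1 := by rw [hx]; rfl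
  have hy' : y.1.val ≠ k + 1 := fun h => hy (Fin.ext h)
  simp only [GraphSpec.Le, markedSpec, hx', hy', Nat.not_succ_lt_self, false_and, dif_neg,
    not_false_eq_true, Nat.succ_ne_self, or_self, if_false]
  exact id

theorem enumerates_markedVertices {ns : List (Fin k × Pos u)} (h : T.IsLinearOutput u ns) :
    Enumerates (T.markedSpec.Node (mark u)) (T.markedSpec.Le (mark u)) (markedVertices ns) := by
  have hns : Enumerates (T.IsNode u) (T.Le u) ns := h.2
  rw [enumerates_iff_pairwise] at hns
  obtain ⟨hmem, hrefl, hpair⟩ := hns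
  have hif : initCopy k ≠ finalCopy k := fun h => by simpa using congrArg Fin.val h
  have hmem' : ∀ x, x ∈ markedVertices ns ↔ x = (initCopy k, leftPos u) ∨
      (∃ y, T.IsNode u y ∧ x = markedVertex y) ∨ x = (finalCopy k, rightPos u) := by
    intro x
    simp only [markedVertices, List.mem_append, List.mem_cons, List.mem_map, List.not_mem_nil,
      or_false, hmem, or_assoc, eq_comm (b := x)]
  rw [enumerates_iff_pairwise]
  refine ⟨fun x => (hmem' x).trans T.node_markedSpec_iff.symm, fun x hx => ?_, ?_⟩
  · rcases (hmem' x).1 hx with rfl | ⟨y, hy, rfl⟩ | rfl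
    · exact T.le_markedSpec_of_eq (Or.inr rfl)
    · exact T.le_markedSpec_markedVertex.2 (hrefl y ((hmem y).2 hy))
    · exact T.le_markedSpec_of_eq (Or.inl rfl)
  · rw [markedVertices, List.pairwise_append, List.pairwise_cons, List.pairwise_map]
    refine ⟨⟨fun x hx => ?_, hpair.imp ?_⟩, List.pairwise_singleton _ _, fun x hx y hy => ?_⟩
    · obtain ⟨y, -, rfl⟩ := List.mem_map.1 hx
      exact ⟨T.le_markedSpec_of_eq (Or.inr rfl), T.not_le_markedSpec_init rfl (castAdd_ne_natAdd _ _)⟩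
    · intro x y hxy
      rwa [le_markedSpec_markedVertex, le_markedSpec_markedVertex]
    · obtain rfl := List.mem_singleton.1 hy
      refine ⟨T.le_markedSpec_of_eq (Or.inl rfl), T.not_le_markedSpec_final rfl ?_⟩
      rcases List.mem_cons.1 hx with rfl | hx
      · exact hif
      · obtain ⟨y, -, rfl⟩ := List.mem_map.1 hx
        exact castAdd_ne_natAdd _ _

theorem isLinear_markedSpec_iff :
    T.markedSpec.IsLinear (mark u) ↔ ∃ ns, T.IsLinearOutput u ns := by
  constructor
  · rintro ⟨h1, h2⟩
    have hn : ∀ x, T.IsNode u x → T.markedSpec.Node (mark u) (markedVertex x) :=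
      fun x hx => T.node_markedSpec_iff.2 (Or.inr (Or.inl ⟨x, hx, rfl⟩))
    have : IsLinearOn (T.IsNode u) (T.Le u) :=
      { total := fun x y hx hy => by
          have := h2.total _ _ (hn x hx) (hn y hy)
          rwa [le_markedSpec_markedVertex, le_markedSpec_markedVertex] at this
        trans := fun x y z hx hy hz => by
          have := h2.trans _ _ _ (hn x hx) (hn y hy) (hn z hz)
          rwa [le_markedSpec_markedVertex, le_markedSpec_markedVertex,
            le_markedSpec_markedVertex] at this
        antisymm := fun x y hx hy => by
          have := h2.antisymm _ _ (hn x hx) (hn y hy)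
          rwa [le_markedSpec_markedVertex, le_markedSpec_markedVertex,
            markedVertex_injective.eq_iff] at this }
    obtain ⟨ns, hns⟩ := this.exists_enumerates
    exact ⟨ns, realize_relativize_sentence.1 h1, hns⟩
  · rintro ⟨ns, h⟩
    exact ⟨realize_relativize_sentence.2 h.1, (T.enumerates_markedVertices h).isLinearOn⟩

/-- The transducer that visits the vertices of the output graph of `T` in increasing order. -/
def toTransducer : Transducer A (Fin b) (Fin (k + 2)) :=
  T.markedSpec.toTransducer (initCopy k) (finalCopy k)

theorem deterministic_toTransducer : T.toTransducer.Deterministic :=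
  GraphSpec.deterministic_toTransducer fun _ => T.exclusive_markedSpec

theorem isAcceptingRun_of_isLinearOutput {ns : List (Fin k × Pos u)} {v : List (Fin b)}
    (h : T.IsLinearOutput u ns) (hv : List.Forall₂ (T.Label u) ns v) :
    T.toTransducer.IsAcceptingRun u (markedVertices ns) v := by
  refine ⟨?_, ⟨(initCopy k, leftPos u), rfl, rfl, rfl⟩,
    ⟨(finalCopy k, rightPos u), ?_, Finset.mem_singleton_self _, rfl⟩⟩
  · have hl := T.isLinear_markedSpec_iff.2 ⟨ns, h⟩
    have hv' : List.Forall₂ (T.markedSpec.Label (mark u))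
        ((initCopy k, leftPos u) :: ns.map markedVertex) ([] :: v.map fun x => [x]) := by
      refine .cons (T.label_markedSpec_init.2 ⟨rfl, rfl⟩) ?_
      rw [List.forall₂_map_left_iff, List.forall₂_map_right_iff]
      exact hv.imp fun x y hxy => T.label_markedSpec_castAdd.2 ⟨_, rfl, _, hxy, rfl⟩
    have := GraphSpec.isRun_of_isChain (init := initCopy k) (final := finalCopy k) hl
      (T.enumerates_markedVertices h).isChain_isNext hv'
    have hflat : ([] :: v.map fun x => [x] : List (List (Fin b))).flatten = v := by
      simp [← List.flatMap_def]
    rw [hflat] at this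
    exact this
  · rw [markedVertices]
    exact List.getLast?_concat

theorem exists_forall₂_label {ns : List (Fin k × Pos u)} (h : T.IsLinearOutput u ns) :
    ∃ v, List.Forall₂ (T.Label u) ns v := by
  have : ∀ x ∈ ns, ∃ y, T.Label u x y := fun x hx => (h.2.1 x).1 hx
  clear h
  induction ns with
  | nil => exact ⟨[], .nil⟩
  | cons x ns ih =>
    obtain ⟨y, hy⟩ := this x (by simp)
    obtain ⟨v, hv⟩ := ih fun z hz => this z (by simp [hz])
    exact ⟨y :: v, .cons hy hv⟩

/-- The final copy lies above every vertex, so that no accepting run continues after its last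
configuration. -/
theorem not_step_final {o : List (Fin b)} {y : Fin (k + 2) × Pos (mark u)}
    {x : Fin (k + 2) × Pos (mark u)} (hx : x.1 = finalCopy k) :
    ¬ T.toTransducer.Step u x o y := by
  intro h
  obtain ⟨-, -, -, h3, -⟩ := GraphSpec.step_iff.1 h
  exact h3 (T.le_markedSpec_of_eq (Or.inl hx))

theorem isAcceptingRun_unique {r r' : List (Fin (k + 2) × Pos (mark u))} {v v' : List (Fin b)}
    (h : T.toTransducer.IsAcceptingRun u r v) (h' : T.toTransducer.IsAcceptingRun u r' v') :
    r = r' ∧ v = v' := by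
  obtain ⟨hr, ⟨x, hx, hx1, hx2⟩, ⟨y, hy, hy1, hy2⟩⟩ := h
  obtain ⟨hr', ⟨x', hx', hx1', hx2'⟩, ⟨y', hy', hy1', hy2'⟩⟩ := h'
  obtain rfl : x = x' := Prod.ext (hx1.trans hx1'.symm) (Fin.ext (hx2.trans hx2'.symm))
  refine hr.unique T.deterministic_toTransducer hr' (hx.trans hx'.symm) ?_ ?_
  · intro z hz o t
    obtain rfl : y = z := Option.mem_some_iff.1 (hy ▸ hz)
    exact T.not_step_final (Finset.mem_singleton.1 hy1)
  · intro z hz o t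
    obtain rfl : y' = z := Option.mem_some_iff.1 (hy' ▸ hz)
    exact T.not_step_final (Finset.mem_singleton.1 hy1')

/-- The first step of an accepting run tests that the output graph is linearly ordered; the run is
then the one that visits its vertices in increasing order. -/
theorem isAcceptingRun_iff {r : List (Fin (k + 2) × Pos (mark u))} {v : List (Fin b)} :
    T.toTransducer.IsAcceptingRun u r v ↔
      ∃ ns, T.IsLinearOutput u ns ∧ List.Forall₂ (T.Label u) ns v ∧ r = markedVertices ns := by
  constructor
  · intro h
    have hlin : T.markedSpec.IsLinear (mark u) := by
      obtain ⟨hr, ⟨x, hx, hx1, -⟩, ⟨y, hy, hy1, -⟩⟩ := h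
      cases hr with
      | single z =>
        -- a single configuration cannot be both initial and final
        obtain rfl : z = x := by simpa using hx
        obtain rfl : z = y := by simpa using hy
        have : initCopy k = finalCopy k := hx1.symm.trans (Finset.mem_singleton.1 hy1)
        simpa using congrArg Fin.val this
      | cons hs _ => exact (GraphSpec.step_iff.1 hs).1
    obtain ⟨ns, hns⟩ := T.isLinear_markedSpec_iff.1 hlin
    obtain ⟨v', hv'⟩ := T.exists_forall₂_label hns
    obtain ⟨rfl, rfl⟩ := T.isAcceptingRun_unique h (T.isAcceptingRun_of_isLinearOutput hns hv')
    exact ⟨ns, hns, hv', rfl⟩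
  · rintro ⟨ns, h, hv, rfl⟩
    exact T.isAcceptingRun_of_isLinearOutput h hv

theorem maps_toTransducer_iff {v : List (Fin b)} : T.toTransducer.Maps u v ↔ T.Maps u v := by
  simp only [Transducer.Maps, isAcceptingRun_iff, Maps]
  constructor
  · rintro ⟨r, ns, h, hv, -⟩
    exact ⟨ns, h, hv⟩
  · rintro ⟨ns, h, hv⟩
    exact ⟨_, ns, h, hv, rfl⟩

/-- Accepting paths in terms of the completed graph over `⊢ u ⊣`, where pumping applies without
special treatment of the endmarkers. -/
theorem isAcceptingPath_iff_enumerates {p : List (Fin (k + 2) × ℕ)} :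
    T.toTransducer.IsAcceptingPath u p ↔ T.markedSpec.IsLinear (mark u) ∧
      ∃ ms, Enumerates (T.markedSpec.Node (mark u)) (T.markedSpec.Le (mark u)) ms ∧
        p = ms.map fun x => (x.1, Fin.val x.2) := by
  simp only [Transducer.IsAcceptingPath, isAcceptingRun_iff]
  constructor
  · rintro ⟨_, v, ⟨ns, h, hv, rfl⟩, rfl⟩
    exact ⟨T.isLinear_markedSpec_iff.2 ⟨ns, h⟩, _, T.enumerates_markedVertices h, rfl⟩
  · rintro ⟨hl, ms, hms, rfl⟩
    obtain ⟨ns, h⟩ := T.isLinear_markedSpec_iff.1 hl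
    obtain ⟨v, hv⟩ := T.exists_forall₂_label h
    exact ⟨_, v, ⟨ns, h, hv, rfl⟩, by rw [hms.unique (T.enumerates_markedVertices h)]⟩

end Transduction

/-! ### Aperiodicity -/

/-- Two enumerations have the same partial images when the fibres of the two partial maps
correspond to each other, compatibly with the predicates and with the orders. -/
theorem Enumerates.filterMap_eq {X X' Y : Type*} {P : X → Prop} {R : X → X → Prop}
    {P' : X' → Prop} {R' : X' → X' → Prop} {l : List X} {l' : List X'}
    (h : Enumerates P R l) (h' : Enumerates P' R' l') {f : X → Option Y} {f' : X' → Option Y}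
    (hf : ∀ x x₂ y, y ∈ f x → y ∈ f x₂ → x = x₂) (hf' : ∀ x x₂ y, y ∈ f' x → y ∈ f' x₂ → x = x₂)
    (hff' : ∀ y, (∃ x, y ∈ f x) ↔ ∃ x', y ∈ f' x')
    (hP : ∀ x x' y, y ∈ f x → y ∈ f' x' → (P x ↔ P' x'))
    (hR : ∀ x x' y x₂ x₂' y₂, y ∈ f x → y ∈ f' x' → y₂ ∈ f x₂ → y₂ ∈ f' x₂' →
      (R x x₂ ↔ R' x' x₂')) :
    l.filterMap f = l'.filterMap f' := by
  let r : Y → Y → Prop := fun y y₂ => ∃ x x₂, y ∈ f x ∧ y₂ ∈ f x₂ ∧ R x x₂ ∧ ¬ R x₂ x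
  have hr : (l.filterMap f).Pairwise r :=
    List.pairwise_filterMap.2 (h.pairwise.imp fun hxy y hy y₂ hy₂ => ⟨_, _, hy, hy₂, hxy⟩)
  have hr' : (l'.filterMap f').Pairwise r := by
    refine List.pairwise_filterMap.2 (h'.pairwise.imp ?_)
    intro x' x₂' hxy y hy y₂ hy₂
    obtain ⟨x, hx⟩ := (hff' y).2 ⟨x', hy⟩
    obtain ⟨x₂, hx₂⟩ := (hff' y₂).2 ⟨x₂', hy₂⟩
    exact ⟨x, x₂, hx, hx₂, (hR _ _ _ _ _ _ hx hy hx₂ hy₂).2 hxy.1,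
      fun hc => hxy.2 ((hR _ _ _ _ _ _ hx₂ hy₂ hx hy).1 hc)⟩
  have hmem : ∀ y, y ∈ l.filterMap f ↔ y ∈ l'.filterMap f' := by
    intro y
    simp only [List.mem_filterMap, h.1, h'.1]
    constructor
    · rintro ⟨x, hx, hy⟩
      obtain ⟨x', hx'⟩ := (hff' y).1 ⟨x, hy⟩
      exact ⟨x', (hP _ _ _ hy hx').1 hx, hx'⟩
    · rintro ⟨x', hx', hy⟩
      obtain ⟨x, hx⟩ := (hff' y).2 ⟨x', hy⟩
      exact ⟨x, (hP _ _ _ hx hy).2 hx', hx⟩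
  refine ((List.perm_ext_iff_of_nodup (h.nodup.filterMap fun x x₂ y => hf x x₂ y)
    (h'.nodup.filterMap fun x x₂ y => hf' x x₂ y)).2 hmem).eq_of_pairwise ?_ hr hr'
  rintro y y₂ - - ⟨x, x₂, hx, hx₂, h1, h2⟩ ⟨z₂, z, hz₂, hz, h3, h4⟩
  rw [hf _ _ _ hz₂ hx₂, hf _ _ _ hz hx] at h3
  exact absurd h3 h2

open Filter in
/-- Pumping a high power changes neither the linearity of a first-order definable graph nor its
vertices and order at the positions outside that power. -/
theorem GraphSpec.eventually_invariant {A B : Type} {q : ℕ} (G : GraphSpec A B q) :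
    ∀ᶠ L in atTop, ∀ (p u r w w' : List A), w = p ++ wordPow u L ++ r →
      w' = p ++ wordPow u (L + 1) ++ r →
      (G.IsLinear w ↔ G.IsLinear w') ∧
      (∀ s (i : Pos w) (i' : Pos w'), Corr p u L i i' → (G.Node w (s, i) ↔ G.Node w' (s, i'))) ∧
      ∀ s t (i j : Pos w) (i' j' : Pos w'), Corr p u L i i' → Corr p u L j j' →
        (G.Le w (s, i) (t, j) ↔ G.Le w' (s, i') (t, j')) := by
  have h1 := eventually_realize_iff (G.linearFormula Empty)
  have h2 := eventually_all.2 fun s => eventually_realize_iff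
    (G.nodeFormula s (Sum.inl 0) : (wordLang A).Formula (Fin 1))
  have h3 := eventually_all.2 fun s => eventually_all.2 fun t =>
    eventually_realize_iff (G.ord s t)
  filter_upwards [h1, h2, h3] with L h1 h2 h3 p u r w w' hw hw'
  refine ⟨?_, fun s i i' hi => ?_, fun s t i j i' j' hi hj => ?_⟩
  · rw [← G.realize_linearFormula (v := (Empty.elim : Empty → Pos w)),
      ← G.realize_linearFormula (v := (Empty.elim : Empty → Pos w'))]
    exact h1 p u r w w' hw hw' _ _ _ _ (fun a => a.elim) fun i => i.elim0
  · have := h2 s p u r w w' hw hw' (fun _ => i) (fun _ => i') default default (fun _ => hi)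
      fun i => i.elim0
    rwa [realize_nodeFormula, realize_nodeFormula] at this
  · refine h3 s t p u r w w' hw hw' ![i, j] ![i', j'] default default (fun a => ?_)
      fun i => i.elim0
    fin_cases a
    · exact hi
    · exact hj

theorem mark_append_wordPow {A : Type} (v u w : List A) (n : ℕ) :
    mark (v ++ wordPow u n ++ w) = (Marked.left :: v.map Marked.letter) ++
      wordPow (u.map Marked.letter) n ++ (w.map Marked.letter ++ [Marked.right]) := by
  simp [mark, wordPow, List.map_flatten]

/-- The partial map that `project` applies to each pair of a path. -/
theorem mem_project_step {A Q : Type} {v u w : List A} {x y : Q × ℕ} :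
    y ∈ (if x.2 ∈ contextPositions v u w then
        some (x.1, (contextPositions v u w).idxOf x.2 + 1) else none) ↔
      y.1 = x.1 ∧ (1 ≤ y.2 ∧ y.2 ≤ v.length ∧ x.2 = y.2 ∨
        v.length < y.2 ∧ y.2 ≤ v.length + w.length ∧ x.2 = y.2 + u.length) := by
  obtain ⟨s, i⟩ := x
  obtain ⟨t, j⟩ := y
  have hget : ∀ b m k, k < m → (List.range' b m).idxOf (b + k) = k := by
    intro b m k hk
    have := (List.nodup_range' (s := b) (n := m)).idxOf_getElem k (by simpa using hk)
    simpa using this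
  rw [Option.mem_def, Option.ite_none_right_eq_some]
  simp only [contextPositions, List.mem_append, List.mem_range'_1, Option.some.injEq,
    Prod.mk.injEq]
  generalize v.length = a, u.length = d, w.length = c
  rcases Nat.lt_or_ge i (a + 1) with hi | hi
  · rcases Nat.eq_zero_or_pos i with h0 | h0
    · omega
    · have hm : i ∈ List.range' 1 a := by rw [List.mem_range'_1]; omega
      have := hget 1 a (i - 1) (by omega)
      rw [show 1 + (i - 1) = i by omega] at this
      rw [List.idxOf_append_of_mem hm, this]
      constructor
      · rintro ⟨-, rfl, rfl⟩
        exact ⟨rfl, Or.inl (by omega)⟩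
      · rintro ⟨rfl, h⟩
        exact ⟨by omega, rfl, by omega⟩
  · have hm : i ∉ List.range' 1 a := by rw [List.mem_range'_1]; omega
    rw [List.idxOf_append_of_notMem hm, List.length_range']
    by_cases hi' : a + d + 1 ≤ i ∧ i < a + d + 1 + c
    · have := hget (a + d + 1) c (i - (a + d + 1)) (by omega)
      rw [show a + d + 1 + (i - (a + d + 1)) = i by omega] at this
      rw [this]
      constructor
      · rintro ⟨-, rfl, rfl⟩
        exact ⟨rfl, Or.inr (by omega)⟩
      · rintro ⟨rfl, h⟩
        exact ⟨by omega, rfl, by omega⟩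
    · constructor
      · rintro ⟨h, -⟩
        omega
      · rintro ⟨-, h⟩
        omega

theorem Transduction.aperiodic_toTransducer {A : Type} {b k : ℕ}
    (T : Transduction A (Fin b) (Fin k)) : T.toTransducer.Aperiodic := by
  obtain ⟨N, hN⟩ := Filter.eventually_atTop.1 T.markedSpec.eventually_invariant
  refine ⟨N + 1, Nat.succ_pos N, fun u v w c => ?_⟩
  obtain ⟨hlin, hnode, hle⟩ := hN (N + 1) (Nat.le_succ N) _ _ _ _ _
    (mark_append_wordPow v u w (N + 1)) (mark_append_wordPow v u w (N + 1 + 1))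
  generalize hn : N + 1 = n at *
  -- the kept vertices of the two words correspond to each other
  have hproj : ∀ ms ms', Enumerates (T.markedSpec.Node (mark (v ++ wordPow u n ++ w)))
      (T.markedSpec.Le (mark (v ++ wordPow u n ++ w))) ms →
      Enumerates (T.markedSpec.Node (mark (v ++ wordPow u (n + 1) ++ w)))
      (T.markedSpec.Le (mark (v ++ wordPow u (n + 1) ++ w))) ms' →
      project (contextPositions v (wordPow u n) w) (ms.map fun x => (x.1, Fin.val x.2)) =
        project (contextPositions v (wordPow u (n + 1)) w)
          (ms'.map fun x => (x.1, Fin.val x.2)) := by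
    intro ms ms' h h'
    have hd : (wordPow u (n + 1)).length = (wordPow u n).length + u.length := by
      simp [Nat.succ_mul]
    have hlen : ∀ n, (mark (v ++ wordPow u n ++ w)).length =
        v.length + (wordPow u n).length + w.length + 2 := by
      intro n
      simp only [length_mark, List.length_append]
    have hcorr : ∀ (i : Pos (mark (v ++ wordPow u n ++ w)))
        (i' : Pos (mark (v ++ wordPow u (n + 1) ++ w))),
        i.val ≤ v.length ∧ i'.val = i.val ∨
          v.length + 1 + (wordPow u n).length ≤ i.val ∧ i'.val = i.val + u.length →
        Corr (Marked.left :: v.map Marked.letter) (u.map Marked.letter) n i i' := by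
      intro i i' hi
      simp only [Corr, List.length_cons, List.length_map]
      rw [length_wordPow] at hi
      omega
    simp only [project, List.filterMap_map]
    refine h.filterMap_eq h' ?_ ?_ ?_ ?_ ?_
    · intro x x₂ y hx hx₂
      rw [Function.comp_apply, mem_project_step] at hx hx₂
      exact Prod.ext (hx.1.symm.trans hx₂.1) (Fin.ext (by omega))
    · intro x x₂ y hx hx₂
      rw [Function.comp_apply, mem_project_step] at hx hx₂
      exact Prod.ext (hx.1.symm.trans hx₂.1) (Fin.ext (by omega))
    · intro y
      refine (exists_congr fun x => mem_project_step).trans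
        (Iff.trans ?_ (exists_congr fun x => mem_project_step).symm)
      constructor
      · rintro ⟨x, hx1, ⟨h1, h2, h3⟩ | ⟨h1, h2, h3⟩⟩
        · exact ⟨(x.1, ⟨y.2, by rw [hlen]; omega⟩), hx1, Or.inl ⟨h1, h2, rfl⟩⟩
        · exact ⟨(x.1, ⟨y.2 + (wordPow u (n + 1)).length, by rw [hlen]; omega⟩), hx1,
            Or.inr ⟨h1, h2, rfl⟩⟩
      · rintro ⟨x, hx1, ⟨h1, h2, h3⟩ | ⟨h1, h2, h3⟩⟩
        · exact ⟨(x.1, ⟨y.2, by rw [hlen]; omega⟩), hx1, Or.inl ⟨h1, h2, rfl⟩⟩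
        · exact ⟨(x.1, ⟨y.2 + (wordPow u n).length, by rw [hlen]; omega⟩), hx1,
            Or.inr ⟨h1, h2, rfl⟩⟩
    · rintro ⟨s, i⟩ ⟨s', i'⟩ y hx hx'
      rw [Function.comp_apply, mem_project_step] at hx hx'
      dsimp only at hx hx'
      obtain rfl : s = s' := hx.1.symm.trans hx'.1
      exact hnode s i i' (hcorr i i' (by omega))
    · rintro ⟨s, i⟩ ⟨s', i'⟩ y ⟨t, j⟩ ⟨t', j'⟩ z hx hx' hz hz'
      rw [Function.comp_apply, mem_project_step] at hx hx' hz hz'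
      dsimp only at hx hx' hz hz'
      obtain rfl : s = s' := hx.1.symm.trans hx'.1
      obtain rfl : t = t' := hz.1.symm.trans hz'.1
      exact hle s t i j i' j' (hcorr i i' (by omega)) (hcorr j j' (by omega))
  simp only [Transducer.IsContextPath, isAcceptingPath_iff_enumerates]
  constructor
  · rintro ⟨_, ⟨hl, ms, hms, rfl⟩, rfl⟩
    obtain ⟨ms', hms'⟩ := (hlin.1 hl).2.exists_enumerates
    exact ⟨_, ⟨hlin.1 hl, ms', hms', rfl⟩, hproj ms ms' hms hms'⟩
  · rintro ⟨_, ⟨hl, ms', hms', rfl⟩, rfl⟩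
    obtain ⟨ms, hms⟩ := (hlin.2 hl).2.exists_enumerates
    exact ⟨_, ⟨hlin.2 hl, ms, hms, rfl⟩, (hproj ms ms' hms hms').symm⟩

/-! ### The construction on finite descriptions -/

section Codes

/-- Description of the negation. -/
def notCode (c : FormulaCode) : FormulaCode := (4, 0, 0) :: (c ++ [(0, 0, 0)])

/-- Description of the implication. -/
def impCode (c d : FormulaCode) : FormulaCode := (4, 0, 0) :: (c ++ d)

/-- Description of the universal quantification of the `n`-th bound variable. -/
def allCode (n : ℕ) (c : FormulaCode) : FormulaCode := (5, 2 * n + 1, 0) :: c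

/-- Description of a finite conjunction. -/
def conjCode (l : List FormulaCode) : FormulaCode :=
  notCode (l.flatMap (fun c => (4, 0, 0) :: c) ++ [(0, 0, 0)])

/-- Description of a finite disjunction. -/
def disjCode (l : List FormulaCode) : FormulaCode :=
  l.flatMap (fun c => (4, 0, 0) :: notCode c) ++ [(0, 0, 0)]

/-- The numbering of variables used in descriptions. -/
def varCode {α : Type} (f : α → ℕ) {n : ℕ} : α ⊕ Fin n → ℕ :=
  Sum.elim (fun a => 2 * f a) fun j => 2 * j.val + 1

/-- Renumbering of the variables when a formula with free variables `0` and `1` is placed under `n`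
quantifiers, its free variables being replaced by the variables numbered `e₀` and `e₁`. -/
def substTerm (n e₀ e₁ t : ℕ) : ℕ :=
  if t % 2 = 1 then t + 2 * n else if t = 0 then e₀ else e₁

/-- Effect of `substTerm` on a symbol: tags `1`, `3` and `5` carry a variable as first argument,
tags `1`, `2` and `3` carry one as second argument. -/
def substSymbol (n e₀ e₁ : ℕ) (x : ℕ × ℕ × ℕ) : ℕ × ℕ × ℕ :=
  (x.1, if x.1 = 1 ∨ x.1 = 3 ∨ x.1 = 5 then substTerm n e₀ e₁ x.2.1 else x.2.1,
    if x.1 = 1 ∨ x.1 = 2 ∨ x.1 = 3 then substTerm n e₀ e₁ x.2.2 else x.2.2)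

/-- Description of the substitution of variables. -/
def substCode (n e₀ e₁ : ℕ) (c : FormulaCode) : FormulaCode := c.map (substSymbol n e₀ e₁)

/-- Effect of relativization on a symbol: letters are renumbered, and a quantifier over `x` is
followed by the prefix `¬ left x → ¬ right x → ·`. -/
def relativizeSymbol (x : ℕ × ℕ × ℕ) : FormulaCode :=
  if x.1 = 2 then [(2, x.2.1 + 2, x.2.2)]
  else if x.1 = 5 then
    [x, (4, 0, 0), (4, 0, 0), (2, 0, x.2.1), (0, 0, 0), (4, 0, 0), (4, 0, 0), (2, 1, x.2.1),
      (0, 0, 0)]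
  else [x]

/-- Description of the relativization of a formula to the letter positions. -/
def relativizeCode (c : FormulaCode) : FormulaCode := c.flatMap relativizeSymbol

variable {A α β : Type} {n : ℕ} {l : A → ℕ} {f : α → ℕ}

@[simp]
theorem formulaCode_not {φ : (wordLang A).BoundedFormula α n} :
    formulaCode l f φ.not = notCode (formulaCode l f φ) := rfl

@[simp]
theorem formulaCode_imp {φ ψ : (wordLang A).BoundedFormula α n} :
    formulaCode l f (φ.imp ψ) = impCode (formulaCode l f φ) (formulaCode l f ψ) := rfl

@[simp]
theorem formulaCode_all {φ : (wordLang A).BoundedFormula α (n + 1)} :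
    formulaCode l f φ.all = allCode n (formulaCode l f φ) := rfl

@[simp]
theorem formulaCode_ex {φ : (wordLang A).BoundedFormula α (n + 1)} :
    formulaCode l f φ.ex = notCode (allCode n (notCode (formulaCode l f φ))) := rfl

@[simp]
theorem formulaCode_bot :
    formulaCode l f (⊥ : (wordLang A).BoundedFormula α n) = [(0, 0, 0)] := rfl

@[simp]
theorem formulaCode_conj {φs : List ((wordLang A).BoundedFormula α n)} :
    formulaCode l f (conj φs) = conjCode (φs.map (formulaCode l f)) := by
  rw [conj, formulaCode_not, conjCode]
  congr 1
  induction φs with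
  | nil => rfl
  | cons φ φs ih => simp [impCode, ih]

@[simp]
theorem formulaCode_disj {φs : List ((wordLang A).BoundedFormula α n)} :
    formulaCode l f (disj φs) = disjCode (φs.map (formulaCode l f)) := by
  rw [disj, disjCode]
  induction φs with
  | nil => rfl
  | cons φ φs ih => simp [impCode, ih]

theorem termCode_var (t : α ⊕ Fin n) :
    termCode f (.var t : (wordLang A).Term (α ⊕ Fin n)) = varCode f t := by
  rcases t with t | t <;> rfl

@[simp]
theorem formulaCode_equal_var (s t : α ⊕ Fin n) :
    formulaCode l f (.equal (.var s) (.var t) : (wordLang A).BoundedFormula α n) =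
      [(1, varCode f s, varCode f t)] := by
  rw [← termCode_var (A := A) s, ← termCode_var (A := A) t]
  rfl

@[simp]
theorem formulaCode_letterFormula (a : A) (t : α ⊕ Fin n) :
    formulaCode l f (letterFormula a t) = [(2, l a, varCode f t)] := by
  rw [← termCode_var (A := A) t]
  rfl

theorem formulaCode_relabel {g : α → β ⊕ Fin n} {f' : β → ℕ} {e₀ e₁ : ℕ}
    (hg : ∀ a, substTerm n e₀ e₁ (2 * f a) = varCode f' (g a)) {m : ℕ}
    (φ : (wordLang A).BoundedFormula α m) :
    formulaCode l f' (φ.relabel g) = substCode n e₀ e₁ (formulaCode l f φ) := by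
  have ht : ∀ {m : ℕ} (t : (wordLang A).Term (α ⊕ Fin m)),
      termCode f' (t.relabel (Language.BoundedFormula.relabelAux g m)) =
        substTerm n e₀ e₁ (termCode f t) := by
    rintro m ((a | j) | ⟨c, _⟩)
    · change _ = substTerm n e₀ e₁ (2 * f a)
      rw [hg, Language.Term.relabel, termCode_var]
      simp only [Language.BoundedFormula.relabelAux, Function.comp_apply, Sum.map_inl]
      rcases g a with b | i
      · rfl
      · simp [varCode]
    · change _ = substTerm n e₀ e₁ (2 * j.val + 1)
      rw [Language.Term.relabel, termCode_var]
      simp [Language.BoundedFormula.relabelAux, varCode, substTerm]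
      omega
    · exact c.elim
  induction φ with
  | falsum => rfl
  | equal s t =>
    have : formulaCode l f' ((Language.BoundedFormula.equal s t).relabel g) =
      [(1, termCode f' (s.relabel (Language.BoundedFormula.relabelAux g _)),
        termCode f' (t.relabel (Language.BoundedFormula.relabelAux g _)))] := rfl
    rw [this, ht, ht]
    rfl
  | rel R ts =>
    cases R with
    | letter a =>
      have : formulaCode l f' ((Language.BoundedFormula.rel
          (WordRel.letter a : (wordLang A).Relations 1) ts).relabel g) =
        [(2, l a, termCode f' ((ts 0).relabel (Language.BoundedFormula.relabelAux g _)))] := rfl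
      rw [this, ht]
      rfl
    | lt =>
      have : formulaCode l f' ((Language.BoundedFormula.rel
          (WordRel.lt : (wordLang A).Relations 2) ts).relabel g) =
        [(3, termCode f' ((ts 0).relabel (Language.BoundedFormula.relabelAux g _)),
          termCode f' ((ts 1).relabel (Language.BoundedFormula.relabelAux g _)))] := rfl
      rw [this, ht, ht]
      rfl
  | imp φ ψ ihφ ihψ =>
    rw [Language.BoundedFormula.relabel_imp, formulaCode_imp, formulaCode_imp, ihφ, ihψ]
    simp [impCode, substCode, substSymbol]
  | @all m φ ih =>
    rw [Language.BoundedFormula.relabel_all, formulaCode_all, formulaCode_all, ih]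
    simp [allCode, substCode, substSymbol, substTerm]
    omega

theorem formulaCode_relativize {a : ℕ} {m : ℕ}
    (φ : (wordLang (Fin a)).BoundedFormula α m) :
    formulaCode markedCode f (relativize φ) = relativizeCode (formulaCode Fin.val f φ) := by
  have ht : ∀ {m : ℕ} (t : (wordLang (Fin a)).Term (α ⊕ Fin m)),
      termCode f (markTerm t) = termCode f t := by
    rintro m (x | ⟨c, _⟩)
    · rw [markTerm, termCode_var, termCode_var]
    · exact c.elim
  induction φ with
  | falsum => rfl
  | equal s t =>
    rw [relativize]
    change [(1, termCode f (markTerm s), termCode f (markTerm t))] = _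
    rw [ht, ht]
    rfl
  | rel R ts =>
    cases R with
    | letter x =>
      change [(2, x.val + 2, termCode f (markTerm (ts 0)))] = _
      rw [ht]
      rfl
    | lt =>
      change [(3, termCode f (markTerm (ts 0)), termCode f (markTerm (ts 1)))] = _
      rw [ht, ht]
      rfl
  | imp φ ψ ihφ ihψ =>
    rw [relativize, formulaCode_imp, formulaCode_imp, ihφ, ihψ]
    simp [impCode, relativizeCode, relativizeSymbol]
  | @all m φ ih =>
    rw [relativize, formulaCode_all, formulaCode_all, formulaCode_imp, formulaCode_imp, ih,
      formulaCode_not, formulaCode_not, formulaCode_letterFormula, formulaCode_letterFormula]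
    simp [allCode, impCode, notCode, relativizeCode, relativizeSymbol, varCode, markedCode]

end Codes

section Codes

/-- Description of the labels of copy `s` in the completed graph. -/
def labCode (c : TransductionCode) (s : ℕ) : List (List ℕ × FormulaCode) :=
  if s < c.1.2.2 then
    (List.range c.1.2.1).map fun x =>
      ([x], conjCode [notCode [(2, 0, 0)], notCode [(2, 1, 0)],
        relativizeCode ((c.2.2.1.getD s []).getD x [])])
  else if s = c.1.2.2 then [([], [(2, 0, 0)])]
  else [([], [(2, 1, 0)])]

/-- Description of the order formulas of the completed graph. -/
def ordCode (c : TransductionCode) (s s' : ℕ) : FormulaCode :=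
  if s' = c.1.2.2 + 1 ∨ s = c.1.2.2 then notCode [(0, 0, 0)]
  else if s < c.1.2.2 ∧ s' < c.1.2.2 then relativizeCode ((c.2.2.2.getD s []).getD s' [])
  else [(0, 0, 0)]

/-- Description of `GraphSpec.nodeFormula`, under `n` quantifiers, for the variable number `t`. The
labelling formulas have a single free variable, so that the second `t` is immaterial. -/
def nodeCode (c : TransductionCode) (s n t : ℕ) : FormulaCode :=
  disjCode ((labCode c s).map fun e => substCode n t t e.2)

/-- Description of `GraphSpec.leFormula`. -/
def leCode (c : TransductionCode) (s s' n t t' : ℕ) : FormulaCode :=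
  substCode n t t' (ordCode c s s')

/-- Description of `GraphSpec.nextFormula`. -/
def nextCode (c : TransductionCode) (s s' n t t' : ℕ) : FormulaCode :=
  conjCode [nodeCode c s' n t', notCode (leCode c s' s n t' t),
    allCode n (conjCode ((List.range (c.1.2.2 + 2)).map fun r =>
      impCode (nodeCode c r (n + 1) (2 * n + 1))
        (disjCode [leCode c r s (n + 1) (2 * n + 1) t, leCode c s' r (n + 1) t' (2 * n + 1)])))]

/-- Description of `GraphSpec.linearAtFormula`. -/
def linearAtCode (c : TransductionCode) (s₁ s₂ s₃ : ℕ) : FormulaCode :=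
  impCode (nodeCode c s₁ 3 1) (impCode (nodeCode c s₂ 3 3) (impCode (nodeCode c s₃ 3 5) (conjCode
    [disjCode [leCode c s₁ s₂ 3 1 3, leCode c s₂ s₁ 3 3 1],
      impCode (leCode c s₁ s₂ 3 1 3) (impCode (leCode c s₂ s₃ 3 3 5) (leCode c s₁ s₃ 3 1 5)),
      impCode (leCode c s₁ s₂ 3 1 3) (impCode (leCode c s₂ s₁ 3 3 1)
        (if s₁ = s₂ then [(1, 1, 3)] else [(0, 0, 0)]))])))

/-- Description of `GraphSpec.linearFormula`. -/
def linearCode (c : TransductionCode) : FormulaCode :=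
  conjCode [substCode 0 0 0 (relativizeCode c.2.1),
    allCode 0 (allCode 1 (allCode 2 (conjCode
      ((List.range (c.1.2.2 + 2)).flatMap fun s₁ => (List.range (c.1.2.2 + 2)).flatMap fun s₂ =>
        (List.range (c.1.2.2 + 2)).map fun s₃ => linearAtCode c s₁ s₂ s₃))))]

/-- Description of `GraphSpec.testFormula`. -/
def testCode (c : TransductionCode) (s s' : ℕ) (d : FormulaCode) : FormulaCode :=
  conjCode [linearCode c, d, notCode (allCode 0 (notCode (nextCode c s s' 1 0 1)))]

/-- Description of `GraphSpec.moveFormula`. -/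
def moveCode (c : TransductionCode) (s s' : ℕ) : FormulaCode :=
  conjCode [linearCode c, nextCode c s s' 0 0 2]

/-- The construction of `Transduction.toTransducer`, on finite descriptions. -/
def transducerCode (c : TransductionCode) : TransducerCode :=
  ((c.1.1, c.1.2.1, c.1.2.2 + 2),
    (List.range (c.1.2.2 + 2)).flatMap fun s => (labCode c s).flatMap fun e =>
      (List.range (c.1.2.2 + 2)).map fun s' =>
        (s, testCode c s s' e.2, s', e.1, moveCode c s s'),
    c.1.2.2, (List.range (c.1.2.2 + 2)).map fun s => decide (s = c.1.2.2 + 1))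

theorem range_eq_map_finRange (n : ℕ) : List.range n = (List.finRange n).map Fin.val :=
  List.ext_getElem (by simp) (by simp)

theorem getD_ofFn {X : Type*} {n : ℕ} (g : Fin n → X) (d : X) (i : Fin n) :
    (List.ofFn g).getD i.val d = g i := by
  simp [List.getD_eq_getElem?_getD]

variable {a b k : ℕ} (T : Transduction (Fin a) (Fin b) (Fin k))

theorem labCode_code (s : Fin (k + 2)) :
    labCode T.code s.val = (T.markedSpec.lab s).map fun e =>
      (e.1.map Fin.val, formulaCode markedCode Fin.val e.2) := by
  have hk : T.code.1.2.2 = k := rfl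
  have hb : T.code.1.2.1 = b := rfl
  simp only [labCode, Transduction.markedSpec, hk, hb]
  split_ifs with h1 h2
  · rw [range_eq_map_finRange, List.map_map, List.map_map]
    refine List.map_congr_left fun x _ => ?_
    have hpos : (T.code.2.2.1.getD s.val []).getD x.val [] =
        formulaCode Fin.val Fin.val (T.pos ⟨s.val, h1⟩ x) := by
      have := getD_ofFn (fun c => List.ofFn fun x => formulaCode Fin.val Fin.val (T.pos c x)) []
        ⟨s.val, h1⟩
      exact (congrArg (fun l => List.getD l x.val []) this).trans (getD_ofFn _ _ _)
    simp only [Function.comp_apply]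
    rw [hpos]
    simp [formulaCode_relativize, varCode, markedCode]
  · simp [varCode, markedCode]
  · simp [varCode, markedCode]

theorem ordCode_code (s s' : Fin (k + 2)) :
    ordCode T.code s.val s'.val = formulaCode markedCode Fin.val (T.markedSpec.ord s s') := by
  have hk : T.code.1.2.2 = k := rfl
  simp only [ordCode, Transduction.markedSpec, hk]
  split_ifs with h1 h2
  · simp
  · have hord : (T.code.2.2.2.getD s.val []).getD s'.val [] =
        formulaCode Fin.val Fin.val (T.ord ⟨s.val, h2.1⟩ ⟨s'.val, h2.2⟩) := by
      have := getD_ofFn (fun c => List.ofFn fun c' => formulaCode Fin.val Fin.val (T.ord c c')) []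
        ⟨s.val, h2.1⟩
      exact (congrArg (fun l => List.getD l s'.val []) this).trans
        (getD_ofFn (fun c' => formulaCode Fin.val Fin.val (T.ord ⟨s.val, h2.1⟩ c')) _
          ⟨s'.val, h2.2⟩)
    rw [hord, formulaCode_relativize]
  · simp

variable {β : Type} {n : ℕ} (f : β → ℕ)

theorem formulaCode_nodeFormula (s : Fin (k + 2)) (t : β ⊕ Fin n) :
    formulaCode markedCode f (T.markedSpec.nodeFormula s t) =
      nodeCode T.code s.val n (varCode f t) := by
  rw [GraphSpec.nodeFormula, nodeCode, formulaCode_disj, labCode_code, List.map_map, List.map_map]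
  congr 1
  refine List.map_congr_left fun e _ => formulaCode_relabel (fun x => ?_) _
  rw [Subsingleton.elim x 0]
  rfl

theorem formulaCode_leFormula (s s' : Fin (k + 2)) (t t' : β ⊕ Fin n) :
    formulaCode markedCode f (T.markedSpec.leFormula s s' t t') =
      leCode T.code s.val s'.val n (varCode f t) (varCode f t') := by
  rw [GraphSpec.leFormula, leCode, ordCode_code]
  refine formulaCode_relabel (fun x => ?_) _
  fin_cases x <;> rfl

theorem varCode_liftVar (t : β ⊕ Fin n) : varCode f (liftVar t) = varCode f t := by
  rcases t with t | t <;> rfl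

theorem formulaCode_nextFormula (s s' : Fin (k + 2)) (t t' : β ⊕ Fin n) :
    formulaCode markedCode f (T.markedSpec.nextFormula s s' t t') =
      nextCode T.code s.val s'.val n (varCode f t) (varCode f t') := by
  have hk : T.code.1.2.2 = k := rfl
  simp only [GraphSpec.nextFormula, nextCode, formulaCode_conj, List.map_cons, List.map_nil,
    formulaCode_nodeFormula, formulaCode_not, formulaCode_leFormula, formulaCode_all,
    List.map_map, hk, range_eq_map_finRange]
  congr 6
  refine List.map_congr_left fun r _ => ?_
  simp only [Function.comp_apply, formulaCode_imp, formulaCode_nodeFormula, formulaCode_disj,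
    List.map_cons, List.map_nil, formulaCode_leFormula, varCode_liftVar]
  rfl

theorem formulaCode_linearAtFormula (s₁ s₂ s₃ : Fin (k + 2)) :
    formulaCode markedCode f (T.markedSpec.linearAtFormula s₁ s₂ s₃) =
      linearAtCode T.code s₁.val s₂.val s₃.val := by
  have h : formulaCode markedCode f (if s₁ = s₂ then
      Language.BoundedFormula.equal (.var (Sum.inr 0)) (.var (Sum.inr 1))
      else ⊥ : (wordLang (Marked (Fin a))).BoundedFormula β 3) =
      if s₁.val = s₂.val then [(1, 1, 3)] else [(0, 0, 0)] := by
    simp only [← Fin.ext_iff]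
    split_ifs
    · simp [varCode]
    · simp
  simp only [GraphSpec.linearAtFormula, formulaCode_imp, formulaCode_nodeFormula, formulaCode_conj,
    formulaCode_disj, List.map_cons, List.map_nil, formulaCode_leFormula, h]
  rfl

theorem formulaCode_linearFormula :
    formulaCode markedCode f (T.markedSpec.linearFormula β) = linearCode T.code := by
  have hk : T.code.1.2.2 = k := rfl
  have hdom : formulaCode markedCode f (n := 0) (substVar Empty.elim T.markedSpec.dom) =
      substCode 0 0 0 (relativizeCode T.code.2.1) := by
    refine (formulaCode_relabel (f := Empty.elim) (e₀ := 0) (e₁ := 0) (fun x => x.elim) _).trans ?_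
    exact congrArg _ (formulaCode_relativize _)
  simp only [GraphSpec.linearFormula, linearCode, formulaCode_conj, List.map_cons, List.map_nil,
    hdom, formulaCode_all, List.map_flatMap, List.map_map, hk, range_eq_map_finRange,
    List.flatMap_map, Function.comp_def, formulaCode_linearAtFormula]

theorem code_toTransducer : transducerCode T.code = T.toTransducer.code := by
  have hk : T.code.1.2.2 = k := rfl
  have htest : ∀ (s s' : Fin (k + 2)) φ,
      formulaCode markedCode Fin.val (T.markedSpec.testFormula s s' φ) =
        testCode T.code s.val s'.val (formulaCode markedCode Fin.val φ) := by
    intro s s' φ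
    simp only [GraphSpec.testFormula, testCode, formulaCode_conj, List.map_cons, List.map_nil,
      formulaCode_linearFormula, formulaCode_ex, formulaCode_nextFormula]
    rfl
  have hmove : ∀ s s' : Fin (k + 2),
      formulaCode markedCode Fin.val (T.markedSpec.moveFormula s s') =
        moveCode T.code s.val s'.val := by
    intro s s'
    simp only [GraphSpec.moveFormula, moveCode, formulaCode_conj, List.map_cons, List.map_nil,
      formulaCode_linearFormula, formulaCode_nextFormula]
    rfl
  refine Prod.ext rfl (Prod.ext ?_ (Prod.ext rfl ?_))
  · simp only [transducerCode, Transducer.code, Transduction.toTransducer, GraphSpec.toTransducer,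
      hk, range_eq_map_finRange, List.flatMap_map, List.map_flatMap, List.map_map, labCode_code,
      Function.comp_def, Transition.code, htest, hmove]
  · simp only [transducerCode, Transducer.code, Transduction.toTransducer, GraphSpec.toTransducer,
      hk, range_eq_map_finRange, List.map_map, List.ofFn_eq_map, Finset.mem_singleton, Fin.ext_iff]
    rfl

end Codes

/-! ### Primitive recursiveness of the construction -/

section Primrec

variable {α : Type} [Primcodable α]

theorem primrec_notCode {c : α → FormulaCode} (hc : Primrec c) :
    Primrec fun x => notCode (c x) :=
  Primrec.list_cons.comp (.const _) (Primrec.list_append.comp hc (.const _))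

theorem primrec_impCode {c d : α → FormulaCode} (hc : Primrec c) (hd : Primrec d) :
    Primrec fun x => impCode (c x) (d x) :=
  Primrec.list_cons.comp (.const _) (Primrec.list_append.comp hc hd)

theorem primrec_allCode {n : α → ℕ} {c : α → FormulaCode} (hn : Primrec n) (hc : Primrec c) :
    Primrec fun x => allCode (n x) (c x) :=
  Primrec.list_cons.comp
    (.pair (.const 5) (.pair (Primrec.succ.comp (Primrec.nat_mul.comp (.const 2) hn)) (.const 0))) hc

theorem primrec_conjCode {l : α → List FormulaCode} (hl : Primrec l) :
    Primrec fun x => conjCode (l x) :=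
  primrec_notCode (Primrec.list_append.comp
    (Primrec.list_flatMap hl (Primrec.list_cons.comp (.const _) Primrec.snd)) (.const _))

theorem primrec_disjCode {l : α → List FormulaCode} (hl : Primrec l) :
    Primrec fun x => disjCode (l x) :=
  Primrec.list_append.comp
    (Primrec.list_flatMap hl (Primrec.list_cons.comp (.const _) (primrec_notCode Primrec.snd)))
    (.const _)

theorem primrec_list_pair {X : Type*} [Primcodable X] {c d : α → X} (hc : Primrec c)
    (hd : Primrec d) : Primrec fun x => [c x, d x] :=
  Primrec.list_cons.comp hc (Primrec.list_cons.comp hd (.const []))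

theorem primrec_list_triple {X : Type*} [Primcodable X] {c d e : α → X} (hc : Primrec c)
    (hd : Primrec d) (he : Primrec e) : Primrec fun x => [c x, d x, e x] :=
  Primrec.list_cons.comp hc (primrec_list_pair hd he)

theorem primrec_substTerm {n e₀ e₁ t : α → ℕ} (hn : Primrec n) (h₀ : Primrec e₀)
    (h₁ : Primrec e₁) (ht : Primrec t) :
    Primrec fun x => substTerm (n x) (e₀ x) (e₁ x) (t x) :=
  Primrec.ite (Primrec.eq.comp (Primrec.nat_mod.comp ht (.const 2)) (.const 1))
    (Primrec.nat_add.comp ht (Primrec.nat_mul.comp (.const 2) hn))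
    (Primrec.ite (Primrec.eq.comp ht (.const 0)) h₀ h₁)

theorem primrec_substSymbol {n e₀ e₁ : α → ℕ} {y : α → ℕ × ℕ × ℕ} (hn : Primrec n)
    (h₀ : Primrec e₀) (h₁ : Primrec e₁) (hy : Primrec y) :
    Primrec fun x => substSymbol (n x) (e₀ x) (e₁ x) (y x) := by
  have h1 := Primrec.fst.comp hy
  have h2 := Primrec.fst.comp (Primrec.snd.comp hy)
  have h3 := Primrec.snd.comp (Primrec.snd.comp hy)
  have htag (i : ℕ) : PrimrecPred fun x => (y x).1 = i := Primrec.eq.comp h1 (.const i)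
  exact .pair h1 (.pair
    (Primrec.ite ((htag 1).or ((htag 3).or (htag 5))) (primrec_substTerm hn h₀ h₁ h2) h2)
    (Primrec.ite ((htag 1).or ((htag 2).or (htag 3))) (primrec_substTerm hn h₀ h₁ h3) h3))

theorem primrec_substCode {n e₀ e₁ : α → ℕ} {c : α → FormulaCode} (hn : Primrec n)
    (h₀ : Primrec e₀) (h₁ : Primrec e₁) (hc : Primrec c) :
    Primrec fun x => substCode (n x) (e₀ x) (e₁ x) (c x) :=
  Primrec.list_map hc (primrec_substSymbol (hn.comp Primrec.fst) (h₀.comp Primrec.fst)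
    (h₁.comp Primrec.fst) Primrec.snd)

theorem primrec_relativizeSymbol : Primrec relativizeSymbol := by
  have h1 : Primrec fun x : ℕ × ℕ × ℕ => x.1 := Primrec.fst
  have h2 : Primrec fun x : ℕ × ℕ × ℕ => x.2.1 := Primrec.fst.comp Primrec.snd
  have h3 : Primrec fun x : ℕ × ℕ × ℕ => x.2.2 := Primrec.snd.comp Primrec.snd
  have hsingle {f : ℕ × ℕ × ℕ → ℕ × ℕ × ℕ} (hf : Primrec f) : Primrec fun x => [f x] :=
    Primrec.list_cons.comp hf (.const [])
  refine Primrec.ite (Primrec.eq.comp h1 (.const 2))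
    (hsingle (.pair (.const 2) (.pair (Primrec.nat_add.comp h2 (.const 2)) h3)))
    (Primrec.ite (Primrec.eq.comp h1 (.const 5)) ?_ (hsingle Primrec.id))
  exact Primrec.list_cons.comp Primrec.id <| Primrec.list_cons.comp (.const _) <|
    Primrec.list_cons.comp (.const _) <|
    Primrec.list_cons.comp (.pair (.const 2) (.pair (.const 0) h2)) <|
    Primrec.list_cons.comp (.const _) <| Primrec.list_cons.comp (.const _) <|
    Primrec.list_cons.comp (.const _) <|
    Primrec.list_cons.comp (.pair (.const 2) (.pair (.const 1) h2)) (.const _)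

theorem primrec_relativizeCode {c : α → FormulaCode} (hc : Primrec c) :
    Primrec fun x => relativizeCode (c x) :=
  Primrec.list_flatMap hc (primrec_relativizeSymbol.comp Primrec.snd)

variable {c : α → TransductionCode}

theorem primrec_numCopies (hc : Primrec c) : Primrec fun x => (c x).1.2.2 :=
  Primrec.snd.comp (Primrec.snd.comp (Primrec.fst.comp hc))

theorem primrec_range_copies (hc : Primrec c) :
    Primrec fun x => List.range ((c x).1.2.2 + 2) :=
  Primrec.list_range.comp (Primrec.nat_add.comp (primrec_numCopies hc) (.const 2))

theorem primrec_labCode {s : α → ℕ} (hc : Primrec c) (hs : Primrec s) :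
    Primrec fun x => labCode (c x) (s x) := by
  have hk := primrec_numCopies hc
  have hb : Primrec fun x => (c x).1.2.1 :=
    Primrec.fst.comp (Primrec.snd.comp (Primrec.fst.comp hc))
  have hpos : Primrec fun x => (c x).2.2.1 :=
    Primrec.fst.comp (Primrec.snd.comp (Primrec.snd.comp hc))
  refine Primrec.ite (Primrec.nat_lt.comp hs hk) ?_
    (Primrec.ite (Primrec.eq.comp hs hk) (.const _) (.const _))
  refine Primrec.list_map (Primrec.list_range.comp hb) (Primrec.pair
    (Primrec.list_cons.comp Primrec.snd (.const []))
    (primrec_conjCode (primrec_list_triple (.const _) (.const _) (primrec_relativizeCode ?_))))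
  exact (Primrec.list_getD []).comp ((Primrec.list_getD []).comp (hpos.comp Primrec.fst)
    (hs.comp Primrec.fst)) Primrec.snd

theorem primrec_ordCode {s s' : α → ℕ} (hc : Primrec c) (hs : Primrec s) (hs' : Primrec s') :
    Primrec fun x => ordCode (c x) (s x) (s' x) := by
  have hk := primrec_numCopies hc
  have hord : Primrec fun x => (c x).2.2.2 :=
    Primrec.snd.comp (Primrec.snd.comp (Primrec.snd.comp hc))
  exact Primrec.ite ((Primrec.eq.comp hs' (Primrec.succ.comp hk)).or (Primrec.eq.comp hs hk))
    (.const _) (Primrec.ite ((Primrec.nat_lt.comp hs hk).and (Primrec.nat_lt.comp hs' hk))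
      (primrec_relativizeCode ((Primrec.list_getD []).comp
        ((Primrec.list_getD []).comp hord hs) hs')) (.const _))

theorem primrec_nodeCode {s n t : α → ℕ} (hc : Primrec c) (hs : Primrec s) (hn : Primrec n)
    (ht : Primrec t) : Primrec fun x => nodeCode (c x) (s x) (n x) (t x) :=
  primrec_disjCode (Primrec.list_map (primrec_labCode hc hs)
    (primrec_substCode (hn.comp Primrec.fst) (ht.comp Primrec.fst) (ht.comp Primrec.fst)
      (Primrec.snd.comp Primrec.snd)))

theorem primrec_leCode {s s' n t t' : α → ℕ} (hc : Primrec c) (hs : Primrec s)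
    (hs' : Primrec s') (hn : Primrec n) (ht : Primrec t) (ht' : Primrec t') :
    Primrec fun x => leCode (c x) (s x) (s' x) (n x) (t x) (t' x) :=
  primrec_substCode hn ht ht' (primrec_ordCode hc hs hs')

theorem primrec_nextCode {s s' n t t' : α → ℕ} (hc : Primrec c) (hs : Primrec s)
    (hs' : Primrec s') (hn : Primrec n) (ht : Primrec t) (ht' : Primrec t') :
    Primrec fun x => nextCode (c x) (s x) (s' x) (n x) (t x) (t' x) := by
  have hn1 : Primrec fun x => n x + 1 := Primrec.succ.comp hn
  have hz : Primrec fun x => 2 * n x + 1 :=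
    Primrec.succ.comp (Primrec.nat_mul.comp (.const 2) hn)
  refine primrec_conjCode (primrec_list_triple (primrec_nodeCode hc hs' hn ht')
    (primrec_notCode (primrec_leCode hc hs' hs hn ht' ht)) (primrec_allCode hn (primrec_conjCode
      (Primrec.list_map (primrec_range_copies hc) (primrec_impCode
        (primrec_nodeCode (hc.comp Primrec.fst) Primrec.snd (hn1.comp Primrec.fst)
          (hz.comp Primrec.fst))
        (primrec_disjCode (primrec_list_pair
          (primrec_leCode (hc.comp Primrec.fst) Primrec.snd (hs.comp Primrec.fst)
            (hn1.comp Primrec.fst) (hz.comp Primrec.fst) (ht.comp Primrec.fst))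
          (primrec_leCode (hc.comp Primrec.fst) (hs'.comp Primrec.fst) Primrec.snd
            (hn1.comp Primrec.fst) (ht'.comp Primrec.fst) (hz.comp Primrec.fst)))))))))

theorem primrec_linearAtCode {s₁ s₂ s₃ : α → ℕ} (hc : Primrec c) (h₁ : Primrec s₁)
    (h₂ : Primrec s₂) (h₃ : Primrec s₃) :
    Primrec fun x => linearAtCode (c x) (s₁ x) (s₂ x) (s₃ x) := by
  have hnode {s : α → ℕ} (hs : Primrec s) (t : ℕ) : Primrec fun x => nodeCode (c x) (s x) 3 t :=
    primrec_nodeCode hc hs (.const 3) (.const t)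
  have hle {s s' : α → ℕ} (hs : Primrec s) (hs' : Primrec s') (t t' : ℕ) :
      Primrec fun x => leCode (c x) (s x) (s' x) 3 t t' :=
    primrec_leCode hc hs hs' (.const 3) (.const t) (.const t')
  exact primrec_impCode (hnode h₁ 1) (primrec_impCode (hnode h₂ 3) (primrec_impCode (hnode h₃ 5)
    (primrec_conjCode (primrec_list_triple
      (primrec_disjCode (primrec_list_pair (hle h₁ h₂ 1 3) (hle h₂ h₁ 3 1)))
      (primrec_impCode (hle h₁ h₂ 1 3) (primrec_impCode (hle h₂ h₃ 3 5) (hle h₁ h₃ 1 5)))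
      (primrec_impCode (hle h₁ h₂ 1 3) (primrec_impCode (hle h₂ h₁ 3 1)
        (Primrec.ite (Primrec.eq.comp h₁ h₂) (.const _) (.const _))))))))

theorem primrec_linearCode (hc : Primrec c) : Primrec fun x => linearCode (c x) := by
  have hdom : Primrec fun x => (c x).2.1 := Primrec.fst.comp (Primrec.snd.comp hc)
  refine primrec_conjCode (primrec_list_pair
    (primrec_substCode (.const 0) (.const 0) (.const 0) (primrec_relativizeCode hdom))
    (primrec_allCode (.const 0) (primrec_allCode (.const 1) (primrec_allCode (.const 2)
      (primrec_conjCode ?_)))))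
  have hc₁ : Primrec fun p : α × ℕ => c p.1 := hc.comp Primrec.fst
  have hc₂ : Primrec fun p : (α × ℕ) × ℕ => c p.1.1 := hc₁.comp Primrec.fst
  exact Primrec.list_flatMap (primrec_range_copies hc) (Primrec.list_flatMap
    (primrec_range_copies hc₁) (Primrec.list_map (primrec_range_copies hc₂)
      (primrec_linearAtCode (hc₂.comp Primrec.fst)
        (Primrec.snd.comp (Primrec.fst.comp Primrec.fst)) (Primrec.snd.comp Primrec.fst)
        Primrec.snd)))

theorem primrec_testCode {s s' : α → ℕ} {d : α → FormulaCode} (hc : Primrec c) (hs : Primrec s)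
    (hs' : Primrec s') (hd : Primrec d) :
    Primrec fun x => testCode (c x) (s x) (s' x) (d x) :=
  primrec_conjCode (primrec_list_triple (primrec_linearCode hc) hd (primrec_notCode
    (primrec_allCode (.const 0) (primrec_notCode
      (primrec_nextCode hc hs hs' (.const 1) (.const 0) (.const 1))))))

theorem primrec_moveCode {s s' : α → ℕ} (hc : Primrec c) (hs : Primrec s) (hs' : Primrec s') :
    Primrec fun x => moveCode (c x) (s x) (s' x) :=
  primrec_conjCode (primrec_list_pair (primrec_linearCode hc)
    (primrec_nextCode hc hs hs' (.const 0) (.const 0) (.const 2)))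

theorem primrec_transducerCode : Primrec transducerCode := by
  have hc : Primrec fun c : TransductionCode => c := Primrec.id
  have hk := primrec_numCopies hc
  have hc₁ : Primrec fun p : TransductionCode × ℕ => p.1 := Primrec.fst
  have hc₂ : Primrec fun p : (TransductionCode × ℕ) × (List ℕ × FormulaCode) => p.1.1 :=
    hc₁.comp Primrec.fst
  have hc₃ : Primrec fun p : ((TransductionCode × ℕ) × (List ℕ × FormulaCode)) × ℕ => p.1.1.1 :=
    hc₂.comp Primrec.fst
  have hs₃ : Primrec fun p : ((TransductionCode × ℕ) × (List ℕ × FormulaCode)) × ℕ => p.1.1.2 :=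
    Primrec.snd.comp (Primrec.fst.comp Primrec.fst)
  have he₃ : Primrec fun p : ((TransductionCode × ℕ) × (List ℕ × FormulaCode)) × ℕ => p.1.2 :=
    Primrec.snd.comp Primrec.fst
  refine .pair (.pair (Primrec.fst.comp Primrec.fst)
    (.pair (Primrec.fst.comp (Primrec.snd.comp Primrec.fst))
      (Primrec.nat_add.comp hk (.const 2)))) (.pair ?_ (.pair hk ?_))
  · exact Primrec.list_flatMap (primrec_range_copies hc) (Primrec.list_flatMap
      (primrec_labCode hc₁ Primrec.snd) (Primrec.list_map (primrec_range_copies hc₂)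
        (Primrec.pair hs₃ (.pair (primrec_testCode hc₃ hs₃ Primrec.snd (Primrec.snd.comp he₃))
          (.pair Primrec.snd (.pair (Primrec.fst.comp he₃)
            (primrec_moveCode hc₃ hs₃ Primrec.snd)))))))
  · exact Primrec.list_map (primrec_range_copies hc)
      (Primrec.eq.decide.comp Primrec.snd (Primrec.succ.comp (hk.comp Primrec.fst)))

end Primrec
end FOWords

theorem mainTheorem4 :
    ∃ F : FOWords.TransductionCode → FOWords.TransducerCode, Computable F ∧
      ∀ (a b k : ℕ) (T : FOWords.Transduction (Fin a) (Fin b) (Fin k)),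
        ∃ M : FOWords.Transducer (Fin a) (Fin b) (Fin (k + 2)),
          -- the transducer `M` is effectively constructed from `T`
          F T.code = M.code ∧
          -- it is deterministic, with at most one accepting path over each word
          M.Deterministic ∧
          (∀ (u : List (Fin a)) (p p' : List (Fin (k + 2) × ℕ)),
            M.IsAcceptingPath u p → M.IsAcceptingPath u p' → p = p') ∧
          -- it realizes the same function over words
          (∀ (u : List (Fin a)) (v : List (Fin b)), M.Maps u v ↔ T.Maps u v) ∧
          -- it is aperiodic
          M.Aperiodic ∧
          -- its states are the `k` copies, the initial state `k` and the final state `k + 1`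
          M.init = Fin.natAdd k 0 ∧ M.final = {Fin.natAdd k 1} ∧
          -- and its head follows the successive nodes of the output structure
          (∀ (u : List (Fin a)) (ns : List (Fin k × FOWords.Pos u)), T.IsLinearOutput u ns →
            M.IsAcceptingPath u
              ((Fin.natAdd k 0, 0) ::
                (ns.map (fun x => (Fin.castAdd 2 x.1, Fin.val x.2 + 1)) ++
                  [(Fin.natAdd k 1, u.length + 1)]))) := by
  refine ⟨FOWords.transducerCode, FOWords.primrec_transducerCode.to_comp, fun a b k T =>
    ⟨T.toTransducer, FOWords.code_toTransducer T, T.deterministic_toTransducer, ?_,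
      fun u v => T.maps_toTransducer_iff, T.aperiodic_toTransducer, rfl, rfl, ?_⟩⟩
  · rintro u _ _ ⟨r, v, h, rfl⟩ ⟨r', v', h', rfl⟩
    rw [(T.isAcceptingRun_unique h h').1]
  · intro u ns h
    obtain ⟨v, hv⟩ := T.exists_forall₂_label h
    refine ⟨_, v, T.isAcceptingRun_of_isLinearOutput h hv, ?_⟩
    simp [FOWords.Transduction.markedVertices, FOWords.Transduction.markedVertex,
      FOWords.leftPos, FOWords.rightPos, FOWords.shiftPos]
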